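/- Let $\mathbb{L}\subset\mathbb{R}$ be the set of Liouville numbers, i.e. of those real $x$ such that for every $n\in\mathbb{N}$ there are integers $a,b$ with $b>1$ and $0<|x-a/b|<b^{-n}$. For $E\subset\mathbb{R}$ let $\tilde{\mathcal F}(E)$ be the set of all functions $f:\mathbb{R}_{\ge 0}\to\mathbb{R}_{\ge 0}$ for which there is a Borel probability measure $\mu$ on $\mathbb{R}$ carried by $E$ (that is, $\mu(\mathbb{R}\setminus E)=0$) whose Fourier transform $\hat\mu(\xi)=\int e^{-2\pi i x\xi}\,d\mu(x)$ satisfies $|\hat\mu(\xi)|\le c\,f(|\xi|)$ for some $c>0$ and all sufficiently large $|\xi|$. Let $\mathcal F(E)$ be the set of classes of elements of $\tilde{\mathcal F}(E)$ under the relation $f\sim g\iff f=O(g)$ and $g=O(f)$ at infinity; we write $f\in\mathcal F(E)$ if the class of $f$ belongs to $\mathcal F(E)$. Theorem. Let $f:\mathbb{R}_{\ge 0}\to\mathbb{R}_{>0}$ be a bounded function that is either decreasing (not necessarily strictly) or continuous. Set $$\tau(\xi)=-\frac{\log f(\xi)}{\log \xi},\qquad \phi(\gamma)=-\log\bigl(f(e^{\gamma})\bigr).$$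 All upper and lower limits are taken in $[-\infty,+\infty]$. (1) Each of the two conditions $$\limsup_{\xi\to+\infty}\tau(\xi)=0\qquad\text{and}\qquad \limsup_{\gamma\to+\infty}\frac{\phi(\gamma)}{\gamma}=0$$ is equivalent to $$\limsup_{\xi\to+\infty}\frac{\xi^{-\alpha}}{f(\xi)}=0\quad\text{for every }\alpha>0,$$ and each of them implies $f\in\mathcal F(\mathbb{L})$. (2) Each of the two conditions $$\liminf_{\xi\to+\infty}\tau(\xi)>0\qquad\text{and}\qquad \liminf_{\gamma\to+\infty}\frac{\phi(\gamma)}{\gamma}>0$$ is equivalent to $$\liminf_{\xi\to+\infty}\frac{\xi^{-\alpha_0}}{f(\xi)}>0\quad\text{for some }\alpha_0>0,$$ and each of them implies $f\notin\mathcal F(\mathbb{L})$. -/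

import Mathlib

open Filter MeasureTheory Asymptotics
open scoped NNReal

namespace LiouvilleFourier

noncomputable section

/-- The set `𝕃 ⊆ ℝ` of Liouville numbers: for every `n` there is a rational `a / b ≠ x` with `b > 1`
and `|x - a / b| < 1 / b ^ n`. -/
def liouvilleNumbers : Set ℝ := {x | Liouville x}

/-- The Fourier transform `ξ ↦ ∫ e ^ (-2 π i x ξ) dμ(x)` of a measure on `ℝ`. -/
def fourierTransform (μ : Measure ℝ) (ξ : ℝ) : ℂ :=
  ∫ x : ℝ, Complex.exp (((-(2 * Real.pi * (x * ξ)) : ℝ) : ℂ) * Complex.I) ∂μ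

/-- The Borel probability measures on `ℝ` that are carried by `E`. -/
def probabilityMeasuresOn (E : Set ℝ) : Set (Measure ℝ) :=
  {μ | IsProbabilityMeasure μ ∧ μ Eᶜ = 0}

/-- The functions `f : ℝ≥0 → ℝ≥0` such that some probability measure `μ` carried by `E` satisfies
`|μ̂(ξ)| ≤ c f(|ξ|)` for all sufficiently large `|ξ|`. -/
def preFourierSet (E : Set ℝ) : Set (ℝ≥0 → ℝ≥0) :=
  {f | ∃ μ ∈ probabilityMeasuresOn E,
    fourierTransform μ =O[cocompact ℝ] (fun ξ : ℝ => (f ‖ξ‖₊ : ℝ))}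

/-- Asymptotic closeness: `f ∼ g` when `f = O(g)` and `g = O(f)` at infinity. -/
def asymptoticallyClose : Setoid (ℝ≥0 → ℝ≥0) where
  r f g := (fun ξ => (f ξ : ℝ)) =O[atTop] (fun ξ => (g ξ : ℝ)) ∧
    (fun ξ => (g ξ : ℝ)) =O[atTop] (fun ξ => (f ξ : ℝ))
  iseqv :=
    { refl := fun _ => ⟨isBigO_refl _ _, isBigO_refl _ _⟩
      symm := fun h => ⟨h.2, h.1⟩
      trans := fun h₁ h₂ => ⟨h₁.1.trans h₂.1, h₂.2.trans h₁.2⟩ }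

/-- The class `[f]` of `f` up to asymptotic closeness. -/
def decayClass (f : ℝ≥0 → ℝ≥0) : Quotient asymptoticallyClose :=
  Quotient.mk asymptoticallyClose f

/-- The Fourier set `𝓕(E)`: the classes, up to asymptotic closeness, of the functions in
`preFourierSet E`. -/
def fourierSet (E : Set ℝ) : Set (Quotient asymptoticallyClose) :=
  decayClass '' preFourierSet E

/-- `τ(ξ) = - log f(ξ) / log ξ`. -/
def tau (f : ℝ≥0 → ℝ≥0) (ξ : ℝ≥0) : ℝ := -Real.log (f ξ) / Real.log ξ

/-- `φ(γ) = - log f(e ^ γ)`. -/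
def phi (f : ℝ≥0 → ℝ≥0) (γ : ℝ) : ℝ := -Real.log (f (Real.exp γ).toNNReal)

/-- For positive `f`: `limsup_{ξ → ∞} ξ ^ (-α) / f(ξ) = 0` for every `α > 0`, the upper limit being
taken in `[-∞, ∞]`. -/
def SlowDecay (f : ℝ≥0 → ℝ≥0) : Prop :=
  ∀ α : ℝ, 0 < α →
    limsup (fun ξ : ℝ≥0 => (((ξ : ℝ) ^ (-α) / (f ξ : ℝ) : ℝ) : EReal)) atTop = 0

/-- For positive `f`: `liminf_{ξ → ∞} ξ ^ (-α₀) / f(ξ) > 0` for some `α₀ > 0`, the lower limit being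
taken in `[-∞, ∞]`. -/
def PowerDecay (f : ℝ≥0 → ℝ≥0) : Prop :=
  ∃ α₀ : ℝ, 0 < α₀ ∧
    0 < liminf (fun ξ : ℝ≥0 => (((ξ : ℝ) ^ (-α₀) / (f ξ : ℝ) : ℝ) : EReal)) atTop

end

end LiouvilleFourier

/-! Negative half. Suppose `μ̂(ξ) = O(|ξ|^(-α))`. If `x` is Liouville, then for infinitely many `b`
all the numbers `j b^p x`, `j < b²`, are close to integers. The mean square over `μ` of the
exponential sum with these frequencies is controlled by `μ̂` at the nonzero multiples of `b^p`, so
Chebyshev's inequality bounds the mass of such `x` by `O(b⁻²)` as soon as `pα ≥ 2`. Borel–Cantelli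
finishes (`measure_liouvilleNumbers_eq_zero`).

Positive half. Start from a probability measure with band-limited transform and multiply repeatedly
by an average, over primes `q ∈ [M, M²]`, of Fejér kernels in `q x`. A kernel of high order
concentrates mass near the fractions `a / q`. If the current transform lives in `[-D, D]` and `q ≥
2D`, the translates by multiples of `q` do not overlap: the transform is unchanged on `[-D, D]`, and
outside it is at most the proportion of `q ∈ P` having a nonzero multiple within `D` of `-ξ`. Few
integers lie that close, and each has boundedly many prime factors `≥ M`, so the proportion is at
most `M^(-1/2)`. It vanishes once `|ξ| > M^R`, and up to there a function decaying more slowly than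
every power still dominates `M^(-1/2)` (`exists_fejerAverage`). Every frequency is altered by at
most one stage beyond its first, so no error accumulates; a weak limit inherits decay and
concentration (`exists_measure_liouvilleNumbers`). Decay at infinity excludes mass on rationals. -/

namespace LiouvilleFourier

/-! ### Characters and the Fourier transform -/

/-- The character `x ↦ e ^ (-2 π i x ξ)` of `ℝ` with frequency `ξ`. -/
noncomputable def wave (ξ x : ℝ) : ℂ :=
  Complex.exp (((-(2 * Real.pi * (x * ξ)) : ℝ) : ℂ) * Complex.I)

lemma fourierTransform_eq_integral_wave (μ : Measure ℝ) (ξ : ℝ) :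
    fourierTransform μ ξ = ∫ x, wave ξ x ∂μ := rfl

lemma norm_wave (ξ x : ℝ) : ‖wave ξ x‖ = 1 := Complex.norm_exp_ofReal_mul_I _

lemma wave_zero_left (x : ℝ) : wave 0 x = 1 := by simp [wave]

lemma wave_add (ξ η x : ℝ) : wave (ξ + η) x = wave ξ x * wave η x := by
  rw [wave, wave, wave, ← Complex.exp_add]
  congr 1
  push_cast
  ring

lemma conj_wave (ξ x : ℝ) : (starRingEnd ℂ) (wave ξ x) = wave (-ξ) x := by
  rw [wave, wave, ← Complex.exp_conj]
  congr 1
  rw [map_mul, Complex.conj_ofReal, Complex.conj_I]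
  push_cast
  ring

lemma wave_re (ξ x : ℝ) : (wave ξ x).re = Real.cos (2 * Real.pi * (x * ξ)) := by
  rw [wave, Complex.exp_ofReal_mul_I_re, Real.cos_neg]

@[fun_prop]
lemma continuous_wave (ξ : ℝ) : Continuous (wave ξ) := by
  unfold wave
  fun_prop

lemma integrable_wave (μ : Measure ℝ) [IsFiniteMeasure μ] (ξ : ℝ) : Integrable (wave ξ) μ :=
  (integrable_const (1 : ℝ)).mono' (continuous_wave ξ).aestronglyMeasurable
    (ae_of_all _ fun x => (norm_wave ξ x).le)

lemma fourierTransform_zero (μ : Measure ℝ) : fourierTransform μ 0 = (μ.real Set.univ : ℂ) := by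
  simp [fourierTransform_eq_integral_wave, wave_zero_left]

lemma norm_fourierTransform_le (μ : Measure ℝ) (ξ : ℝ) :
    ‖fourierTransform μ ξ‖ ≤ μ.real Set.univ := by
  refine (norm_integral_le_integral_norm _).trans ?_
  change ∫ x, ‖wave ξ x‖ ∂μ ≤ _
  simp [norm_wave]

lemma charFun_eq_fourierTransform (μ : Measure ℝ) (t : ℝ) :
    charFun μ t = fourierTransform μ (-(t / (2 * Real.pi))) := by
  rw [charFun_apply_real, fourierTransform]
  congr 1
  ext x
  congr 1
  have := Real.pi_pos.ne'
  push_cast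
  field_simp

/-! ### Mean squares of exponential sums, and the null sets they give -/

lemma norm_sum_wave_sq (J : ℕ) (c x : ℝ) :
    ((‖∑ j ∈ Finset.range J, wave (j * c) x‖ ^ 2 : ℝ) : ℂ) =
      ∑ j ∈ Finset.range J, ∑ k ∈ Finset.range J, wave (((j : ℝ) - k) * c) x := by
  rw [Complex.ofReal_pow, ← Complex.mul_conj', map_sum, Finset.sum_mul_sum]
  refine Finset.sum_congr rfl fun j _ => Finset.sum_congr rfl fun k _ => ?_
  rw [conj_wave, ← wave_add]
  congr 1
  ring

lemma integral_norm_sum_wave_sq (μ : Measure ℝ) [IsFiniteMeasure μ] (J : ℕ) (c : ℝ) :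
    ((∫ x, ‖∑ j ∈ Finset.range J, wave (j * c) x‖ ^ 2 ∂μ : ℝ) : ℂ) =
      ∑ j ∈ Finset.range J, ∑ k ∈ Finset.range J, fourierTransform μ (((j : ℝ) - k) * c) := by
  rw [← integral_complex_ofReal]
  simp_rw [norm_sum_wave_sq]
  rw [integral_finsetSum _ fun j _ => integrable_finsetSum _ fun k _ => integrable_wave μ _]
  refine Finset.sum_congr rfl fun j _ => ?_
  rw [integral_finsetSum _ fun k _ => integrable_wave μ _]
  rfl

/-- If `μ̂` is at most `ε` at the nonzero multiples of `c`, few points `x` have all of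
`j c x`, `j < J`, close to an integer. -/
lemma measure_wave_near_one_le (μ : Measure ℝ) [IsProbabilityMeasure μ] {J : ℕ} (hJ : 0 < J)
    {c ε : ℝ} (hε : 0 ≤ ε)
    (h : ∀ l : ℤ, l ≠ 0 → ‖fourierTransform μ (l * c)‖ ≤ ε) :
    μ {x | ∀ j < J, 1 / 2 ≤ (wave (j * c) x).re} ≤ ENNReal.ofReal (4 * (1 / J + ε)) := by
  have hJ' : (0 : ℝ) < J := by exact_mod_cast hJ
  set F : ℝ → ℝ := fun x => ‖∑ j ∈ Finset.range J, wave (j * c) x‖ ^ 2 with hF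
  have hFc : Continuous F := by fun_prop
  have hFi : Integrable F μ := by
    refine (integrable_const ((J : ℝ) ^ 2)).mono' hFc.aestronglyMeasurable (ae_of_all _ fun x => ?_)
    rw [Real.norm_of_nonneg (by positivity)]
    have := norm_sum_le (Finset.range J) (fun j : ℕ => wave (j * c) x)
    simp only [norm_wave, Finset.sum_const, Finset.card_range, nsmul_eq_mul, mul_one] at this
    exact pow_le_pow_left₀ (norm_nonneg _) this 2
  -- The `J` diagonal terms contribute at most 1 each, the others at most `ε` each.
  have hint : ∫ x, F x ∂μ ≤ J + J ^ 2 * ε := by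
    have h1 : ∫ x, F x ∂μ = ‖((∫ x, F x ∂μ : ℝ) : ℂ)‖ := by
      rw [Complex.norm_real, Real.norm_of_nonneg (integral_nonneg fun x => by positivity)]
    rw [h1, integral_norm_sum_wave_sq]
    have h2 : ∀ j ∈ Finset.range J,
        ‖∑ k ∈ Finset.range J, fourierTransform μ (((j : ℝ) - k) * c)‖ ≤ 1 + J * ε := by
      intro j hj
      have h3 : ∀ k ∈ Finset.range J, ‖fourierTransform μ (((j : ℝ) - k) * c)‖ ≤
          (if k = j then 1 else 0) + ε := by
        intro k _
        split_ifs with hk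
        · subst hk
          have := norm_fourierTransform_le μ (((k : ℝ) - k) * c)
          simp only [probReal_univ] at this
          linarith
        · have := h ((j : ℤ) - k) (by omega)
          push_cast at this
          simpa using this
      refine (norm_sum_le_of_le _ h3).trans ?_
      rw [Finset.sum_add_distrib, Finset.sum_ite_eq']
      simp [hj]
    refine (norm_sum_le_of_le _ h2).trans (le_of_eq ?_)
    simp
    ring
  -- No cancellation is possible on this set, so Markov's inequality at height `(J/2)²` applies.
  have hsub : {x | ∀ j < J, 1 / 2 ≤ (wave (j * c) x).re} ⊆ {x | (J / 2 : ℝ) ^ 2 ≤ F x} := by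
    intro x hx
    have h1 : (J / 2 : ℝ) ≤ (∑ j ∈ Finset.range J, wave (j * c) x).re := by
      rw [Complex.re_sum]
      refine le_trans (le_of_eq ?_) (Finset.sum_le_sum
        fun j hj => hx j (Finset.mem_range.1 hj))
      simp
      ring
    have h2 := h1.trans (Complex.re_le_norm _)
    simp only [Set.mem_ofPred_eq, hF]
    gcongr
  have hmark := mul_meas_ge_le_integral_of_nonneg (μ := μ)
    (ae_of_all _ fun x => (by positivity : 0 ≤ F x)) hFi ((J / 2 : ℝ) ^ 2)
  refine (measure_mono hsub).trans ?_
  rw [← ofReal_measureReal]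
  refine ENNReal.ofReal_le_ofReal ?_
  have : (J / 2 : ℝ) ^ 2 * μ.real {x | (J / 2 : ℝ) ^ 2 ≤ F x} ≤ J + J ^ 2 * ε := hmark.trans hint
  rw [show 4 * (1 / (J : ℝ) + ε) = (J + J ^ 2 * ε) / (J / 2 : ℝ) ^ 2 by field_simp; ring]
  rw [le_div_iff₀ (by positivity)]
  linarith

/-- The tolerance `1/6` corresponds to the angle `π/3`, whose cosine is `1/2`. -/
lemma half_le_wave_re {ξ x : ℝ} {k : ℤ} (h : |x * ξ - k| ≤ 1 / 6) : 1 / 2 ≤ (wave ξ x).re := by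
  rw [wave_re, show 2 * Real.pi * (x * ξ) = 2 * Real.pi * (x * ξ - k) + k * (2 * Real.pi) by ring,
    Real.cos_add_int_mul_two_pi, ← Real.cos_abs, ← Real.cos_pi_div_three]
  have hpi := Real.pi_pos
  apply Real.cos_le_cos_of_nonneg_of_le_pi (abs_nonneg _) (by linarith)
  rw [abs_mul, abs_of_pos (by positivity : 0 < 2 * Real.pi)]
  nlinarith

/-- A measure with polynomial Fourier decay gives no mass to the set of Liouville numbers. -/
theorem measure_liouvilleNumbers_eq_zero (μ : Measure ℝ) [IsProbabilityMeasure μ] {C α R : ℝ}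
    (hα : 0 < α) (h : ∀ ξ : ℝ, R ≤ |ξ| → ‖fourierTransform μ ξ‖ ≤ C * |ξ| ^ (-α)) :
    μ liouvilleNumbers = 0 := by
  -- With `pα ≥ 2` the transform at nonzero multiples of `b^p` is `O(b⁻²)`, which is summable over
  -- `b`.
  obtain ⟨p, hp⟩ := exists_nat_gt (2 / α)
  have hp0 : p ≠ 0 := by
    rintro rfl
    have : (0 : ℝ) < 2 / α := by positivity
    simp at hp
    linarith
  have hpα : 2 ≤ p * α := by rw [div_lt_iff₀ hα] at hp; exact hp.le
  obtain ⟨N, hN⟩ := exists_nat_ge (max R 2)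
  set A : ℕ → Set ℝ := fun b => {x | ∀ j < b ^ 2, 1 / 2 ≤ (wave (j * (b : ℝ) ^ p) x).re} with hA
  set B : ℕ → Set ℝ := fun b => if N ≤ b then A b else ∅ with hB
  have hbound : ∀ b, μ (B b) ≤ ENNReal.ofReal (4 * (1 + |C|) * (1 / (b : ℝ) ^ 2)) := by
    intro b
    by_cases hb : N ≤ b
    swap
    · simp [hB, hb]
    have hbN : (N : ℝ) ≤ b := by exact_mod_cast hb
    have hb2 : (2 : ℝ) ≤ b := (le_max_right _ _).trans (hN.trans hbN)
    have hbR : R ≤ b := (le_max_left _ _).trans (hN.trans hbN)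
    have hbpos : 0 < b ^ 2 := by
      have : 0 < b := by exact_mod_cast (by linarith : (0 : ℝ) < b)
      positivity
    have hc : (b : ℝ) ≤ (b : ℝ) ^ p := le_self_pow₀ (by linarith) hp0
    simp only [hB, hb, if_true, hA]
    refine (measure_wave_near_one_le μ hbpos (c := (b : ℝ) ^ p) (ε := |C| * (1 / (b : ℝ) ^ 2))
      (by positivity) ?_).trans (le_of_eq ?_)
    · intro l hl
      have hl1 : (1 : ℝ) ≤ |(l : ℝ)| := by exact_mod_cast Int.one_le_abs hl
      have hlc : (b : ℝ) ^ p ≤ |(l : ℝ) * (b : ℝ) ^ p| := by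
        rw [abs_mul, abs_of_pos (by positivity : (0 : ℝ) < (b : ℝ) ^ p)]
        exact le_mul_of_one_le_left (by positivity) hl1
      refine (h _ (by linarith)).trans ?_
      have h1 : |(l : ℝ) * (b : ℝ) ^ p| ^ (-α) ≤ 1 / (b : ℝ) ^ 2 := by
        refine (Real.rpow_le_rpow_of_nonpos (by positivity) hlc (by linarith)).trans ?_
        rw [← Real.rpow_natCast, ← Real.rpow_mul (by positivity), one_div, ← Real.rpow_natCast,
          ← Real.rpow_neg (by positivity)]
        apply Real.rpow_le_rpow_of_exponent_le (by linarith)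
        push_cast
        linarith
      calc C * |(l : ℝ) * (b : ℝ) ^ p| ^ (-α) ≤ |C| * |(l : ℝ) * (b : ℝ) ^ p| ^ (-α) := by
            gcongr
            exact le_abs_self C
        _ ≤ _ := by gcongr
    · push_cast
      ring_nf
  have hsum : ∑' b, μ (B b) ≠ ⊤ := by
    refine ne_top_of_le_ne_top ?_ (ENNReal.tsum_le_tsum hbound)
    exact ((Real.summable_one_div_nat_pow.2 one_lt_two).mul_left _).tsum_ofReal_ne_top
  have hlim : μ {x | ∃ᶠ b in atTop, x ∈ B b} = 0 :=
    measure_setOfPred_frequently_eq_zero hsum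
  refine measure_mono_null (fun x hx => ?_) hlim
  -- The exponent `p + 5` leaves an error `b² b^p b^(-(p+5)) = b⁻³ ≤ 1/8` after multiplication by `j
  -- b^p`.
  refine ((Liouville.frequently_exists_num hx (p + 5)).and_eventually
    (eventually_ge_atTop N)).mono ?_
  rintro b ⟨⟨a, -, ha⟩, hb⟩
  have hbN : (N : ℝ) ≤ b := by exact_mod_cast hb
  have hb2 : (2 : ℝ) ≤ b := (le_max_right _ _).trans (hN.trans hbN)
  simp only [hB, hb, if_true, hA]
  intro j (hj : j < b ^ 2)
  have hj' : (j : ℝ) ≤ (b : ℝ) ^ 2 := by exact_mod_cast hj.le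
  obtain ⟨k, rfl⟩ : ∃ k, p = k + 1 := ⟨p - 1, by omega⟩
  refine half_le_wave_re (k := j * b ^ k * a) ?_
  have hb0 : (b : ℝ) ≠ 0 := by linarith
  have h1 : x * (j * (b : ℝ) ^ (k + 1)) - ((j * b ^ k * a : ℤ) : ℝ) =
      j * (b : ℝ) ^ (k + 1) * (x - a / b) := by
    push_cast
    field_simp
    ring
  rw [h1, abs_mul, abs_of_nonneg (by positivity)]
  calc j * (b : ℝ) ^ (k + 1) * |x - a / b|
      ≤ (b : ℝ) ^ 2 * (b : ℝ) ^ (k + 1) * (1 / (b : ℝ) ^ (k + 1 + 5)) := by gcongr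
    _ = 1 / (b : ℝ) ^ 3 := by field_simp; ring
    _ ≤ 1 / 2 ^ 3 := by gcongr
    _ ≤ 1 / 6 := by norm_num

/-- A measure whose Fourier transform vanishes at infinity gives no mass to the rationals. -/
theorem measure_range_ratCast_eq_zero (μ : Measure ℝ) [IsProbabilityMeasure μ]
    (h : Tendsto (fourierTransform μ) (cocompact ℝ) (nhds 0)) :
    μ (Set.range ((↑) : ℚ → ℝ)) = 0 := by
  refine measure_mono_null (t := ⋃ q : ℚ, {(q : ℝ)}) (by simp) ?_
  rw [measure_iUnion_null_iff]
  intro q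
  refine le_antisymm (ENNReal.le_of_forall_pos_le_add fun ε hε _ => ?_) bot_le
  obtain ⟨J, hJ⟩ := exists_nat_gt (8 / (ε : ℝ))
  have hε' : (0 : ℝ) < ε := hε
  have hJ0 : (0 : ℝ) < J := lt_trans (by positivity) hJ
  have h1 : ∀ᶠ ξ in cocompact ℝ, ‖fourierTransform μ ξ‖ ≤ ε / 8 := by
    have := h.norm
    rw [norm_zero] at this
    exact this.eventually_le_const (by positivity)
  rw [← Metric.cobounded_eq_cocompact, ← comap_norm_atTop, eventually_comap] at h1
  obtain ⟨T, hT⟩ := eventually_atTop.1 h1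
  obtain ⟨M, hM⟩ := exists_nat_ge (max T 1)
  have hM1 : (1 : ℝ) ≤ M := (le_max_right _ _).trans hM
  have hd : (1 : ℝ) ≤ q.den := by exact_mod_cast q.pos
  -- With `c = M * q.den` every `j c q` is an integer, while all nonzero multiples of `c` lie beyond
  -- `T`.
  have hbound := measure_wave_near_one_le μ (J := J) (by exact_mod_cast hJ0)
    (c := (M * q.den : ℝ)) (ε := ε / 8) (by positivity) ?_
  · rw [zero_add]
    refine (measure_mono ?_).trans (hbound.trans ?_)
    · rw [Set.singleton_subset_iff]
      intro j _
      refine half_le_wave_re (k := j * M * q.num) ?_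
      have h2 : (q : ℝ) * q.den = q.num := by exact_mod_cast Rat.mul_den_eq_num q
      have h3 : (q : ℝ) * (j * (M * q.den)) = j * M * q.num := by rw [← h2]; ring
      rw [h3]
      simp
    · rw [← ENNReal.ofReal_coe_nnreal]
      apply ENNReal.ofReal_le_ofReal
      have : 1 / (J : ℝ) ≤ ε / 8 := by
        rw [div_lt_iff₀ hε'] at hJ
        rw [div_le_iff₀ hJ0]
        linarith
      linarith
  · intro l hl
    refine hT _ ?_ _ rfl
    have hl1 : (1 : ℝ) ≤ |(l : ℝ)| := by exact_mod_cast Int.one_le_abs hl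
    rw [Real.norm_eq_abs, abs_mul, abs_of_nonneg (by positivity : 0 ≤ (M * q.den : ℝ))]
    calc T ≤ M := (le_max_left _ _).trans hM
      _ ≤ |(l : ℝ)| * (M * q.den) := by nlinarith [mul_le_mul hl1 hd zero_le_one (by positivity)]

/-! ### Fejér averages and their effect on the Fourier transform -/

/-- The average over `q ∈ P` of the Fejér kernels of order `L` at `q x`. -/
noncomputable def fejerAverage (P : Finset ℕ) (L : ℕ) (x : ℝ) : ℝ :=
  (∑ q ∈ P, ‖∑ j ∈ Finset.range L, wave (j * q) x‖ ^ 2) / (P.card * L)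

lemma fejerAverage_nonneg (P : Finset ℕ) (L : ℕ) (x : ℝ) : 0 ≤ fejerAverage P L x := by
  unfold fejerAverage
  positivity

@[fun_prop]
lemma continuous_fejerAverage (P : Finset ℕ) (L : ℕ) : Continuous (fejerAverage P L) := by
  unfold fejerAverage
  fun_prop

lemma fejerAverage_le (P : Finset ℕ) (L : ℕ) (x : ℝ) : fejerAverage P L x ≤ L := by
  unfold fejerAverage
  have h : ∀ q ∈ P, ‖∑ j ∈ Finset.range L, wave (j * q) x‖ ^ 2 ≤ (L : ℝ) ^ 2 := by
    intro q _
    have := norm_sum_le (Finset.range L) (fun j : ℕ => wave (j * q) x)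
    simp only [norm_wave, Finset.sum_const, Finset.card_range, nsmul_eq_mul, mul_one] at this
    exact pow_le_pow_left₀ (norm_nonneg _) this 2
  have h2 := Finset.sum_le_sum h
  simp only [Finset.sum_const, nsmul_eq_mul] at h2
  apply div_le_of_le_mul₀ (by positivity) (by positivity)
  linarith

/-- The measure with density `fejerAverage P L` with respect to `μ`. -/
noncomputable def fejerMeasure (μ : Measure ℝ) (P : Finset ℕ) (L : ℕ) : Measure ℝ :=
  μ.withDensity fun x => ENNReal.ofReal (fejerAverage P L x)

instance isFiniteMeasure_fejerMeasure (μ : Measure ℝ) [IsFiniteMeasure μ] (P : Finset ℕ) (L : ℕ) :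
    IsFiniteMeasure (fejerMeasure μ P L) := by
  refine isFiniteMeasure_withDensity_ofReal (HasFiniteIntegral.of_bounded (C := (L : ℝ))
    (ae_of_all _ fun x => ?_))
  rw [Real.norm_of_nonneg (fejerAverage_nonneg P L x)]
  exact fejerAverage_le P L x

lemma fourierTransform_fejerMeasure (μ : Measure ℝ) [IsFiniteMeasure μ] (P : Finset ℕ) (L : ℕ)
    (ξ : ℝ) :
    fourierTransform (fejerMeasure μ P L) ξ =
      (∑ q ∈ P, ∑ j ∈ Finset.range L, ∑ k ∈ Finset.range L,
        fourierTransform μ (ξ + ((j : ℝ) - k) * q)) / (P.card * L) := by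
  have h1 : ∀ x, (ENNReal.ofReal (fejerAverage P L x)).toReal • wave ξ x =
      (∑ q ∈ P, ∑ j ∈ Finset.range L, ∑ k ∈ Finset.range L,
        wave (ξ + ((j : ℝ) - k) * q) x) / (P.card * L) := by
    intro x
    rw [ENNReal.toReal_ofReal (fejerAverage_nonneg P L x), fejerAverage, Complex.real_smul]
    rw [Complex.ofReal_div, Complex.ofReal_sum, div_mul_eq_mul_div, Finset.sum_mul]
    simp_rw [norm_sum_wave_sq, Finset.sum_mul, wave_add ξ, mul_comm (wave ξ x)]
    simp
  rw [fourierTransform_eq_integral_wave, fejerMeasure,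
    integral_withDensity_eq_integral_toReal_smul (by fun_prop) (ae_of_all _ fun x => by simp)]
  simp_rw [h1]
  rw [integral_div]
  congr 1
  rw [integral_finsetSum _ fun q _ => integrable_finsetSum _ fun j _ =>
    integrable_finsetSum _ fun k _ => integrable_wave μ _]
  refine Finset.sum_congr rfl fun q _ => ?_
  rw [integral_finsetSum _ fun j _ => integrable_finsetSum _ fun k _ => integrable_wave μ _]
  refine Finset.sum_congr rfl fun j _ => ?_
  rw [integral_finsetSum _ fun k _ => integrable_wave μ _]
  rfl

-- The diagonal `j = k` produces `L * φ ξ`. Distinct translates by multiples of `q ≥ 2D` have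
-- disjoint supports, so for each `j` at most one other `k` survives, and none unless `ξ` is
-- resonant.
open Classical in
lemma norm_sum_shift_sub_le {φ : ℝ → ℂ} {m D q : ℝ} (hm : ∀ η, ‖φ η‖ ≤ m)
    (hsupp : ∀ η, D ≤ |η| → φ η = 0) (hq : 2 * D ≤ q) (L : ℕ) (ξ : ℝ) :
    ‖∑ j ∈ Finset.range L, ∑ k ∈ Finset.range L, φ (ξ + ((j : ℝ) - k) * q) - L * φ ξ‖ ≤
      if ∃ l : ℤ, l ≠ 0 ∧ |l| < L ∧ |ξ + l * q| < D then L * m else 0 := by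
  have hm0 : 0 ≤ m := (norm_nonneg _).trans (hm 0)
  have h1 : ∑ j ∈ Finset.range L, ∑ k ∈ Finset.range L, φ (ξ + ((j : ℝ) - k) * q) - L * φ ξ =
      ∑ j ∈ Finset.range L, ∑ k ∈ (Finset.range L).erase j, φ (ξ + ((j : ℝ) - k) * q) := by
    rw [sub_eq_iff_eq_add]
    have : (L : ℂ) * φ ξ = ∑ j ∈ Finset.range L, φ ξ := by simp
    rw [this, ← Finset.sum_add_distrib]
    refine Finset.sum_congr rfl fun j hj => ?_
    rw [← Finset.sum_erase_add _ _ hj]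
    simp
  rw [h1]
  split_ifs with h
  · have h2 : ∀ j ∈ Finset.range L,
        ‖∑ k ∈ (Finset.range L).erase j, φ (ξ + ((j : ℝ) - k) * q)‖ ≤ m := by
      intro j _
      by_cases hk : ∃ k ∈ (Finset.range L).erase j, |ξ + ((j : ℝ) - k) * q| < D
      · obtain ⟨k, hk, hkD⟩ := hk
        have hD : 0 < D := (abs_nonneg _).trans_lt hkD
        rw [Finset.sum_eq_single_of_mem k hk]
        · exact hm _
        · intro k' _ hne
          apply hsupp
          by_contra! hk'
          have h3 : |((k : ℝ) - k') * q| < 2 * D := by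
            calc |((k : ℝ) - k') * q|
                = |(ξ + ((j : ℝ) - k') * q) - (ξ + ((j : ℝ) - k) * q)| := by congr 1; ring
              _ ≤ _ := abs_sub _ _
              _ < 2 * D := by linarith
          have h4 : (1 : ℝ) ≤ |(k : ℝ) - k'| := by
            have : (1 : ℤ) ≤ |(k : ℤ) - k'| := Int.one_le_abs (by omega)
            exact_mod_cast this
          rw [abs_mul, abs_of_pos (by linarith : 0 < q)] at h3
          nlinarith
      · push Not at hk
        rw [Finset.sum_eq_zero fun k hk' => hsupp _ (hk k hk')]
        simpa using hm0
    refine (norm_sum_le_of_le _ h2).trans (le_of_eq ?_)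
    simp
  · push Not at h
    rw [Finset.sum_eq_zero, norm_zero]
    intro j hj
    refine Finset.sum_eq_zero fun k hk => hsupp _ ?_
    simp only [Finset.mem_erase, Finset.mem_range] at hk hj
    have := h ((j : ℤ) - k) (by omega) (by rw [abs_lt]; omega)
    push_cast at this
    exact this

open Classical in
/-- The values of `q ∈ P` that contribute to the change of the Fourier transform at `ξ` caused by
the density `fejerAverage P L`. -/
noncomputable def resonantSet (P : Finset ℕ) (L : ℕ) (D ξ : ℝ) : Finset ℕ :=
  P.filter fun q => ∃ l : ℤ, l ≠ 0 ∧ |l| < L ∧ |ξ + l * q| < D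

section

variable {μ : Measure ℝ} [IsFiniteMeasure μ] {P : Finset ℕ} {L : ℕ} {D : ℝ}

lemma norm_fourierTransform_fejerMeasure_sub_le (hP : P.Nonempty) (hL : 0 < L)
    (hsupp : ∀ η, D ≤ |η| → fourierTransform μ η = 0) (hq : ∀ q ∈ P, 2 * D ≤ q) (ξ : ℝ) :
    ‖fourierTransform (fejerMeasure μ P L) ξ - fourierTransform μ ξ‖ ≤
      μ.real Set.univ * ((resonantSet P L D ξ).card / P.card) := by
  classical
  have hP0 : (0 : ℝ) < P.card := by exact_mod_cast hP.card_pos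
  have hL0 : (0 : ℝ) < L := by exact_mod_cast hL
  have hP0' : (P.card : ℂ) ≠ 0 := by exact_mod_cast hP0.ne'
  have hL0' : (L : ℂ) ≠ 0 := by exact_mod_cast hL0.ne'
  have h1 : fourierTransform (fejerMeasure μ P L) ξ - fourierTransform μ ξ =
      (∑ q ∈ P, (∑ j ∈ Finset.range L, ∑ k ∈ Finset.range L,
        fourierTransform μ (ξ + ((j : ℝ) - k) * q) - L * fourierTransform μ ξ)) /
          (P.card * L) := by
    rw [fourierTransform_fejerMeasure, Finset.sum_sub_distrib, sub_div]
    congr 1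
    simp only [Finset.sum_const, nsmul_eq_mul]
    field_simp
  rw [h1, norm_div, norm_mul, Complex.norm_natCast, Complex.norm_natCast,
    div_le_iff₀ (by positivity)]
  refine (norm_sum_le_of_le _ fun q hqP =>
    norm_sum_shift_sub_le (norm_fourierTransform_le μ) hsupp (hq q hqP) L ξ).trans ?_
  rw [← Finset.sum_filter, Finset.sum_const, nsmul_eq_mul]
  apply le_of_eq
  simp only [resonantSet]
  field_simp

lemma resonantSet_eq_empty (hq : ∀ q ∈ P, 2 * D ≤ q) {ξ : ℝ} (hξ : |ξ| ≤ D) :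
    resonantSet P L D ξ = ∅ := by
  classical
  rw [resonantSet, Finset.filter_eq_empty_iff]
  rintro q hqP ⟨l, hl, -, h⟩
  have hl1 : (1 : ℝ) ≤ |(l : ℝ)| := by exact_mod_cast Int.one_le_abs hl
  have h1 : |(l : ℝ) * q| ≤ |ξ + l * q| + |ξ| := by
    calc |(l : ℝ) * q| = |(ξ + l * q) - ξ| := by congr 1; ring
      _ ≤ _ := abs_sub _ _
  have h2 := hq q hqP
  rw [abs_mul, Nat.abs_cast] at h1
  nlinarith [(Nat.cast_nonneg q : (0 : ℝ) ≤ q)]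

/-- No resonance occurs for `|ξ| ≤ D`, since nonzero multiples of `q` have size at least `2D`. At `ξ
= 0` this says that total mass is preserved, so no normalisation is needed. -/
lemma fourierTransform_fejerMeasure_eq (hP : P.Nonempty) (hL : 0 < L)
    (hsupp : ∀ η, D ≤ |η| → fourierTransform μ η = 0) (hq : ∀ q ∈ P, 2 * D ≤ q) {ξ : ℝ}
    (hξ : |ξ| ≤ D) : fourierTransform (fejerMeasure μ P L) ξ = fourierTransform μ ξ := by
  have := norm_fourierTransform_fejerMeasure_sub_le hP hL hsupp hq ξ
  rw [resonantSet_eq_empty hq hξ] at this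
  simpa [sub_eq_zero] using this

lemma fourierTransform_fejerMeasure_eq_zero
    (hsupp : ∀ η, D ≤ |η| → fourierTransform μ η = 0) {ξ : ℝ}
    (hξ : D + L * ∑ q ∈ P, (q : ℝ) ≤ |ξ|) : fourierTransform (fejerMeasure μ P L) ξ = 0 := by
  rw [fourierTransform_fejerMeasure, Finset.sum_eq_zero, zero_div]
  refine fun q hqP => Finset.sum_eq_zero fun j hj => Finset.sum_eq_zero fun k hk => hsupp _ ?_
  have h1 : (q : ℝ) ≤ ∑ q ∈ P, (q : ℝ) :=
    Finset.single_le_sum (f := fun q : ℕ => (q : ℝ)) (fun _ _ => Nat.cast_nonneg _) hqP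
  have h2 : |(j : ℝ) - k| ≤ L := by
    have hj' : (j : ℝ) < L := by exact_mod_cast Finset.mem_range.1 hj
    have hk' : (k : ℝ) < L := by exact_mod_cast Finset.mem_range.1 hk
    have hj0 : (0 : ℝ) ≤ j := Nat.cast_nonneg _
    have hk0 : (0 : ℝ) ≤ k := Nat.cast_nonneg _
    rw [abs_le]
    constructor <;> linarith
  have h3 : |ξ| ≤ |ξ + ((j : ℝ) - k) * q| + |((j : ℝ) - k) * q| := by
    calc |ξ| = |(ξ + ((j : ℝ) - k) * q) - ((j : ℝ) - k) * q| := by congr 1; ring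
      _ ≤ _ := abs_sub _ _
  rw [abs_mul, Nat.abs_cast] at h3
  have h4 : |(j : ℝ) - k| * q ≤ L * ∑ q ∈ P, (q : ℝ) := by gcongr
  linarith

end

/-! ### Concentration near rationals -/

/-- The points `x` for which some `q x`, `q ∈ P`, is within `δ` of an integer. -/
def nearRationals (P : Finset ℕ) (δ : ℝ) : Set ℝ := {x | ∃ q ∈ P, ∃ a : ℤ, |x * q - a| ≤ δ}

/-- Openness lets upper bounds for the mass pass to a weak limit. -/
lemma isOpen_compl_nearRationals (P : Finset ℕ) (δ : ℝ) : IsOpen (nearRationals P δ)ᶜ := by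
  have h : (nearRationals P δ)ᶜ = ⋂ q ∈ P, {x : ℝ | δ < ‖((x * q : ℝ) : UnitAddCircle)‖} := by
    ext x
    simp only [nearRationals, Set.mem_compl_iff, Set.mem_ofPred_eq, not_exists, not_and, not_le,
      Set.mem_iInter, UnitAddCircle.norm_eq]
    exact forall₂_congr fun q _ => ⟨fun h => h _, fun h a => h.trans_le (round_le _ a)⟩
  rw [h]
  refine isOpen_biInter_finset fun q _ => isOpen_lt continuous_const ?_
  exact continuous_norm.comp ((AddCircle.continuous_mk' (1 : ℝ)).comp (by fun_prop))

/-- Here `|e^(-2πiu) - 1| = 2 |sin πu| ≥ 4 |u|` for `|u| ≤ 1/2`, by Jordan's inequality. -/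
lemma four_mul_le_norm_wave_sub_one {ξ x δ : ℝ} (h : ∀ a : ℤ, δ ≤ |x * ξ - a|) :
    4 * δ ≤ ‖wave ξ x - 1‖ := by
  set u := x * ξ - round (x * ξ) with hu
  have hu2 : |u| ≤ 1 / 2 := abs_sub_round _
  have hpi := Real.pi_pos
  have h1 : ‖wave ξ x - 1‖ = 2 * |Real.sin (Real.pi * (x * ξ))| := by
    rw [wave, mul_comm, Complex.norm_exp_I_mul_ofReal_sub_one, norm_mul, Real.norm_eq_abs,
      Real.norm_eq_abs, abs_two]
    rw [show -(2 * Real.pi * (x * ξ)) / 2 = -(Real.pi * (x * ξ)) by ring, Real.sin_neg, abs_neg]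
  have h2 : |Real.sin (Real.pi * (x * ξ))| = |Real.sin (Real.pi * u)| := by
    rw [show Real.pi * (x * ξ) = Real.pi * u + round (x * ξ) * Real.pi by rw [hu]; ring,
      Real.sin_add_int_mul_pi, abs_mul, abs_zpow, abs_neg, abs_one, one_zpow, one_mul]
  have h3 : 2 / Real.pi * |Real.pi * u| ≤ |Real.sin (Real.pi * u)| := by
    apply Real.mul_abs_le_abs_sin
    rw [abs_mul, abs_of_pos hpi]
    nlinarith
  rw [abs_mul, abs_of_pos hpi, show 2 / Real.pi * (Real.pi * |u|) = 2 * |u| by field_simp] at h3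
  have h4 := h (round (x * ξ))
  rw [h1, h2]
  linarith

/-- Summing the geometric series bounds each exponential sum by `2 / (4δ)`. The bound is pointwise,
hence usable against any probability measure. -/
lemma fejerAverage_le_of_notMem {P : Finset ℕ} {L : ℕ} {δ x : ℝ} (hδ : 0 < δ)
    (hx : x ∉ nearRationals P δ) : fejerAverage P L x ≤ 1 / (4 * L * δ ^ 2) := by
  have hq : ∀ q ∈ P, ‖∑ j ∈ Finset.range L, wave (j * q) x‖ ^ 2 ≤ 1 / (4 * δ ^ 2) := by
    intro q hqP
    have h1 : 4 * δ ≤ ‖wave q x - 1‖ := by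
      refine four_mul_le_norm_wave_sub_one fun a => ?_
      by_contra! hlt
      exact hx ⟨q, hqP, a, hlt.le⟩
    have h2 : ∀ j : ℕ, wave (j * q) x = wave q x ^ j := by
      intro j
      induction j with
      | zero => simp [wave_zero_left]
      | succ j ih =>
        rw [pow_succ, ← ih, ← wave_add]
        push_cast
        ring_nf
    have h3 : ‖∑ j ∈ Finset.range L, wave (j * q) x‖ * ‖wave q x - 1‖ ≤ 2 := by
      simp_rw [← norm_mul, h2]
      rw [geom_sum_mul, ← h2]
      refine (norm_sub_le _ _).trans ?_
      rw [norm_wave, norm_one]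
      norm_num
    have h4 : ‖∑ j ∈ Finset.range L, wave (j * q) x‖ ≤ 1 / (2 * δ) := by
      rw [le_div_iff₀ (by positivity)]
      nlinarith [norm_nonneg (∑ j ∈ Finset.range L, wave (j * q) x)]
    refine (pow_le_pow_left₀ (norm_nonneg _) h4 2).trans (le_of_eq ?_)
    field_simp
    norm_num
  unfold fejerAverage
  rcases Nat.eq_zero_or_pos L with rfl | hL
  · simp
  have hL0 : (0 : ℝ) < L := by exact_mod_cast hL
  refine div_le_of_le_mul₀ (by positivity) (by positivity) ((Finset.sum_le_sum hq).trans ?_)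
  simp only [Finset.sum_const, nsmul_eq_mul]
  apply le_of_eq
  field_simp

/-! ### Counting resonant primes and choosing the parameters -/

/-- The product of the distinct primes dividing `s` also divides `s`, and each is at least `M`. -/
lemma card_filter_dvd_lt {P : Finset ℕ} {M R : ℕ} (hM : 0 < M) (hP : ∀ q ∈ P, q.Prime ∧ M ≤ q)
    {s : ℤ} (hs : s ≠ 0) (hsR : |s| < (M : ℤ) ^ R) :
    (P.filter fun q : ℕ => (q : ℤ) ∣ s).card ≤ R := by
  by_contra! hcard
  have h1 : ∏ q ∈ P.filter (fun q : ℕ => (q : ℤ) ∣ s), q ∣ s.natAbs := by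
    apply Finset.prod_primes_dvd
    · intro q hq
      exact (hP q (Finset.mem_filter.1 hq).1).1.prime
    · intro q hq
      exact Int.natCast_dvd.1 (Finset.mem_filter.1 hq).2
  have h2 := Nat.le_of_dvd (Int.natAbs_pos.2 hs) h1
  have h3 := Finset.pow_card_le_prod (P.filter fun q : ℕ => (q : ℤ) ∣ s) (fun q => q) M
    fun q hq => (hP q (Finset.mem_filter.1 hq).1).2
  have h4 : M ^ R ≤ M ^ (P.filter fun q : ℕ => (q : ℤ) ∣ s).card := Nat.pow_le_pow_right hM hcard.le
  have h5 : s.natAbs < M ^ R := by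
    zify
    exact hsR
  omega

/-- A resonant `q` divides a nonzero integer within `D` of `-ξ` and below `M^R` in size; there are
at most `2D + 1` of these, each with at most `R` divisors in `P`. -/
lemma card_resonantSet_le {P : Finset ℕ} {L M R D : ℕ} (hM : 0 < M)
    (hP : ∀ q ∈ P, q.Prime ∧ M ≤ q ∧ L * q < M ^ R) (ξ : ℝ) :
    ((resonantSet P L D ξ).card : ℝ) ≤ (2 * D + 1) * R := by
  classical
  set T : Finset ℤ := (Finset.Icc ⌈-ξ - D⌉ ⌊-ξ + D⌋).filter
    fun s => s ≠ 0 ∧ |s| < (M : ℤ) ^ R with hT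
  have hsub : resonantSet P L D ξ ⊆ T.biUnion fun s => P.filter fun q : ℕ => (q : ℤ) ∣ s := by
    intro q hq
    rw [resonantSet, Finset.mem_filter] at hq
    obtain ⟨hqP, l, hl, hlL, hlD⟩ := hq
    obtain ⟨hqp, hMq, hqL⟩ := hP q hqP
    have hq0 : (0 : ℤ) < q := by exact_mod_cast hqp.pos
    rw [Finset.mem_biUnion]
    refine ⟨l * q, ?_, Finset.mem_filter.2 ⟨hqP, dvd_mul_left _ _⟩⟩
    rw [abs_lt] at hlD
    rw [hT, Finset.mem_filter, Finset.mem_Icc, Int.ceil_le, Int.le_floor]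
    push_cast
    refine ⟨⟨by linarith, by linarith⟩, mul_ne_zero hl hq0.ne', ?_⟩
    rw [abs_mul, Nat.abs_cast]
    have : (L * q : ℤ) < (M : ℤ) ^ R := by exact_mod_cast hqL
    nlinarith
  have h1 : (resonantSet P L D ξ).card ≤ T.card * R := by
    refine (Finset.card_le_card hsub).trans (Finset.card_biUnion_le_card_mul _ _ _ fun s hs => ?_)
    have hs' := (Finset.mem_filter.1 hs).2
    exact card_filter_dvd_lt hM (fun q hq => ⟨(hP q hq).1, (hP q hq).2.1⟩) hs'.1 hs'.2
  have h2 : (T.card : ℝ) ≤ 2 * D + 1 := by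
    have h3 : T.card ≤ (⌊-ξ + D⌋ + 1 - ⌈-ξ - D⌉).toNat := by
      rw [← Int.card_Icc]
      exact Finset.card_filter_le _ _
    have h4 : ((⌊-ξ + D⌋ + 1 - ⌈-ξ - D⌉ : ℤ) : ℝ) ≤ 2 * D + 1 := by
      push_cast
      linarith [Int.floor_le (-ξ + D), Int.le_ceil (-ξ - D)]
    have h5 : (⌊-ξ + D⌋ + 1 - ⌈-ξ - D⌉ : ℤ) ≤ 2 * D + 1 := by exact_mod_cast h4
    have h6 : T.card ≤ 2 * D + 1 := by omega
    exact_mod_cast h6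
  calc ((resonantSet P L D ξ).card : ℝ) ≤ T.card * R := by exact_mod_cast h1
    _ ≤ (2 * D + 1) * R := by gcongr

/-- Chebyshev's lower bound gives at least `2M` primes up to `M²`; at most `M` of them are below
`M`. -/
lemma eventually_le_card_primes :
    ∀ᶠ M : ℕ in atTop, M ≤ ((Finset.Icc M (M ^ 2)).filter Nat.Prime).card := by
  have hlog : ∀ᶠ M : ℕ in atTop, Real.log M ≤ 1 / 16 * M := by
    have := (Real.isLittleO_log_id_atTop.comp_tendsto tendsto_natCast_atTop_atTop).bound
      (show (0 : ℝ) < 1 / 16 by norm_num)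
    filter_upwards [this] with M hM
    simp only [Function.comp_apply, id, Real.norm_eq_abs, Nat.abs_cast] at hM
    exact (le_abs_self _).trans hM
  filter_upwards [hlog, eventually_ge_atTop 2] with M hM hM2
  have hM2' : (2 : ℝ) ≤ M := by exact_mod_cast hM2
  have hl0 : 0 < Real.log M := Real.log_pos (by linarith)
  have h1 := Chebyshev.pi_ge (M ^ 2)
  push_cast at h1
  rw [Real.log_pow, div_le_iff₀ (by push_cast; positivity)] at h1
  have h2 : Real.log ((M : ℝ) ^ 2 + 1) ≤ 3 * Real.log M := by
    have : Real.log ((M : ℝ) ^ 2 + 1) ≤ Real.log ((M : ℝ) ^ 3) := by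
      apply Real.log_le_log (by positivity)
      nlinarith
    rwa [Real.log_pow] at this
  have h3 : (2 * M : ℝ) ≤ (M ^ 2).primeCounting := by
    by_contra! hlt
    have h4 : ((M ^ 2).primeCounting : ℝ) * (2 * Real.log M) ≤ 2 * M * (2 * (1 / 16 * M)) := by
      gcongr
    have h5 := Real.log_two_gt_d9
    push_cast at h1
    nlinarith
  have h4 : Nat.primesLE (M ^ 2) ⊆
      Finset.range M ∪ (Finset.Icc M (M ^ 2)).filter Nat.Prime := by
    intro q hq
    rw [Nat.primesLE_eq_filter_range, Finset.mem_filter, Finset.mem_range] at hq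
    rw [Finset.mem_union, Finset.mem_range, Finset.mem_filter, Finset.mem_Icc]
    by_cases h : q < M
    · exact Or.inl h
    · exact Or.inr ⟨⟨by omega, by omega⟩, hq.2⟩
  have h5 := (Finset.card_le_card h4).trans (Finset.card_union_le _ _)
  rw [Nat.primesLE_card_eq_primeCounting, Finset.card_range] at h5
  have h6 : 2 * M ≤ (M ^ 2).primeCounting := by exact_mod_cast h3
  omega

/-- A Fejér average concentrated near rationals, with little effect on Fourier transforms
supported in `[-D, D]`. -/
theorem exists_fejerAverage {F : ℝ → ℝ} (hF0 : ∀ ξ, 0 ≤ F ξ)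
    (hF : ∀ α : ℝ, 0 < α → ∀ᶠ ξ in atTop, ξ ^ (-α) ≤ F ξ) (n D : ℕ) :
    ∃ (P : Finset ℕ) (L : ℕ) (δ : ℝ), P.Nonempty ∧ 0 < L ∧
      (∀ q ∈ P, q.Prime ∧ 2 * D ≤ q ∧ δ < q * (1 / (q : ℝ) ^ n)) ∧
      (∀ ξ, ((resonantSet P L D ξ).card : ℝ) / P.card ≤ F |ξ|) ∧
      ∀ x ∉ nearRationals P δ, fejerAverage P L x ≤ (1 / 2) ^ n := by
  -- With `L = M^(5n)`, resonant frequencies have size at most `D + L M² ≤ 2 L M² ≤ M^R`.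
  set R : ℕ := 5 * n + 3 with hR
  have hR0 : (0 : ℝ) < R := by rw [hR]; positivity
  -- The exponent `1/(2R)` turns `|ξ| ≤ M^R` into `F |ξ| ≥ M^(-1/2)`.
  obtain ⟨X, hX⟩ := eventually_atTop.1 (hF (1 / (2 * R)) (by positivity))
  have hsqrt : Tendsto (fun M : ℕ => √(M : ℝ)) atTop atTop :=
    Real.tendsto_sqrt_atTop.comp tendsto_natCast_atTop_atTop
  obtain ⟨M, hcard, hM2, hMD, hMX, hMR⟩ := (eventually_le_card_primes.and
    ((eventually_ge_atTop 2).and ((eventually_ge_atTop (2 * D)).and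
    ((tendsto_natCast_atTop_atTop.eventually_ge_atTop (D + X + 1)).and
    (hsqrt.eventually_ge_atTop ((2 * D + 1) * R)))))).exists
  set P := (Finset.Icc M (M ^ 2)).filter Nat.Prime with hP
  set L := M ^ (5 * n) with hL
  have hM0 : 0 < M := by omega
  have hM0' : (0 : ℝ) < M := by exact_mod_cast hM0
  have hM2' : (2 : ℝ) ≤ M := by exact_mod_cast hM2
  have hMD' : (2 * D : ℝ) ≤ M := by exact_mod_cast hMD
  have hLM : L * M ^ 2 * 2 ≤ M ^ R := by
    calc L * M ^ 2 * 2 ≤ L * M ^ 2 * M := by gcongr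
      _ = M ^ R := by rw [hL, hR]; ring
  have hL0 : 0 < L := by positivity
  have hmem : ∀ q ∈ P, q.Prime ∧ M ≤ q ∧ q ≤ M ^ 2 := by
    intro q hq
    rw [hP, Finset.mem_filter, Finset.mem_Icc] at hq
    exact ⟨hq.2, hq.1⟩
  have hPcard : (M : ℝ) ≤ P.card := by exact_mod_cast hcard
  -- As `q ≤ M²`, this `δ` is at most `q^(-n)`; and `L δ² = M^n` gives the concentration bound.
  refine ⟨P, L, 1 / (M : ℝ) ^ (2 * n), Finset.card_pos.1 (by omega), hL0, ?_, ?_, ?_⟩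
  · intro q hq
    obtain ⟨hqp, hMq, hqM⟩ := hmem q hq
    refine ⟨hqp, by omega, ?_⟩
    have hq1 : (1 : ℝ) < q := by exact_mod_cast hqp.one_lt
    have hqM' : (q : ℝ) ≤ (M : ℝ) ^ 2 := by exact_mod_cast hqM
    have h1 : 1 / (M : ℝ) ^ (2 * n) ≤ 1 / (q : ℝ) ^ n := by
      rw [pow_mul]
      gcongr
    have h2 : 0 < 1 / (q : ℝ) ^ n := by positivity
    nlinarith
  · intro ξ
    rcases (resonantSet P L D ξ).eq_empty_or_nonempty with hempty | ⟨q, hq⟩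
    · rw [hempty]
      simpa using hF0 _
    have hcount := card_resonantSet_le (L := L) (R := R) (D := D) hM0 (fun q hq =>
      ⟨(hmem q hq).1, (hmem q hq).2.1, ?_⟩) ξ
    swap
    · have := (hmem q hq).2.2
      calc L * q ≤ L * M ^ 2 := by gcongr
        _ < L * M ^ 2 * 2 := by
          have : 0 < L * M ^ 2 := by positivity
          omega
        _ ≤ _ := hLM
    classical
    rw [resonantSet, Finset.mem_filter] at hq
    obtain ⟨hqP, l, hl, hlL, hlD⟩ := hq
    obtain ⟨hqp, hMq, hqM⟩ := hmem q hqP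
    have hMq' : (M : ℝ) ≤ q := by exact_mod_cast hMq
    have hqM' : (q : ℝ) ≤ (M : ℝ) ^ 2 := by exact_mod_cast hqM
    have hl1 : (1 : ℝ) ≤ |(l : ℝ)| := by exact_mod_cast Int.one_le_abs hl
    have hlL' : |(l : ℝ)| ≤ L := by exact_mod_cast hlL.le
    have hlq : |(l : ℝ) * q| = |(l : ℝ)| * q := by rw [abs_mul, Nat.abs_cast]
    -- Resonance forces `|ξ| ≥ M - D`, inside the range where the lower bound on `F` holds.
    have hlow : X + 1 ≤ |ξ| := by
      have h1 : |(l : ℝ) * q| ≤ |ξ + l * q| + |ξ| := by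
        calc |(l : ℝ) * q| = |(ξ + l * q) - ξ| := by congr 1; ring
          _ ≤ _ := abs_sub _ _
      have h2 : (M : ℝ) ≤ |(l : ℝ)| * q := by nlinarith
      linarith
    have hξ0 : 0 < |ξ| := by
      have h1 : |(l : ℝ) * q| ≤ |ξ + l * q| + |ξ| := by
        calc |(l : ℝ) * q| = |(ξ + l * q) - ξ| := by congr 1; ring
          _ ≤ _ := abs_sub _ _
      have h2 : (M : ℝ) ≤ |(l : ℝ)| * q := by nlinarith
      linarith
    have hup : |ξ| ≤ (M : ℝ) ^ R := by
      have h1 : |ξ| ≤ |ξ + l * q| + |(l : ℝ) * q| := by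
        calc |ξ| = |(ξ + l * q) - l * q| := by congr 1; ring
          _ ≤ _ := abs_sub _ _
      have h2 : |(l : ℝ)| * q ≤ L * (M : ℝ) ^ 2 := by gcongr
      have h3 : (L * (M : ℝ) ^ 2 * 2) ≤ (M : ℝ) ^ R := by exact_mod_cast hLM
      have h4 : (D : ℝ) ≤ L * (M : ℝ) ^ 2 := by
        have : (1 : ℝ) ≤ L := by exact_mod_cast hL0
        nlinarith
      linarith
    have hFξ : 1 / √(M : ℝ) ≤ F |ξ| := by
      refine le_trans ?_ (hX |ξ| (by linarith))
      refine le_trans (le_of_eq ?_) (Real.rpow_le_rpow_of_nonpos hξ0 hup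
        (by rw [neg_nonpos]; positivity))
      rw [← Real.rpow_natCast, ← Real.rpow_mul hM0'.le, Real.sqrt_eq_rpow, one_div,
        ← Real.rpow_neg hM0'.le]
      congr 1
      field_simp
    refine le_trans ?_ hFξ
    have hs0 : 0 < √(M : ℝ) := Real.sqrt_pos.2 hM0'
    rw [div_le_div_iff₀ (by linarith) hs0, one_mul]
    calc ((resonantSet P L D ξ).card : ℝ) * √M ≤ √M * √M := by
          gcongr
          exact hcount.trans hMR
      _ = M := Real.mul_self_sqrt hM0'.le
      _ ≤ P.card := hPcard
  · intro x hx
    refine (fejerAverage_le_of_notMem (by positivity) hx).trans ?_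
    rw [hL]
    push_cast
    calc 1 / (4 * (M : ℝ) ^ (5 * n) * (1 / (M : ℝ) ^ (2 * n)) ^ 2)
        = 1 / 4 * (1 / (M : ℝ)) ^ n := by
          rw [one_div_pow, one_div_pow, ← pow_mul,
            show 5 * n = 2 * n * 2 + n by ring, pow_add]
          field_simp
      _ ≤ 1 * (1 / (2 : ℝ)) ^ n := by
          gcongr
          norm_num
      _ = _ := one_mul _

/-! ### A probability measure with compactly supported Fourier transform -/

open scoped FourierTransform

/-- The triangle function `max (1 - |t|) 0`. -/
noncomputable def triangle (t : ℝ) : ℂ := ((max (1 - |t|) 0 : ℝ) : ℂ)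

lemma continuous_triangle : Continuous triangle := by
  unfold triangle
  fun_prop

lemma triangle_eq_zero {t : ℝ} (ht : 1 ≤ |t|) : triangle t = 0 := by
  rw [triangle, max_eq_right (by linarith), Complex.ofReal_zero]

lemma integrable_triangle : Integrable triangle := by
  refine continuous_triangle.integrable_of_hasCompactSupport
    (HasCompactSupport.intro (isCompact_Icc (a := (-1 : ℝ)) (b := 1)) fun t ht => ?_)
  apply triangle_eq_zero
  by_contra! h
  exact ht (abs_le.1 h.le)

/-- Explicit antiderivatives on `[-1, 0]` and `[0, 1]` suffice. The closed form shows both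
nonnegativity and decay like `w⁻²`. -/
lemma fourier_triangle {w : ℝ} (hw : w ≠ 0) :
    𝓕 triangle w = (((1 - Real.cos (2 * Real.pi * w)) / (2 * (Real.pi * w) ^ 2) : ℝ) : ℂ) := by
  set c : ℂ := -(2 * Real.pi * w) * Complex.I with hc
  have hpi : (Real.pi : ℂ) ≠ 0 := by exact_mod_cast Real.pi_pos.ne'
  have hw' : (w : ℂ) ≠ 0 := by exact_mod_cast hw
  have hc0 : c ≠ 0 := by simp [hc, hpi, hw']
  set G : ℝ → ℂ := fun v => Complex.exp (c * v) * triangle v with hG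
  have hGc : Continuous G := by
    have := continuous_triangle
    fun_prop
  have h1 : 𝓕 triangle w = ∫ v, G v := by
    rw [Real.fourier_real_eq_integral_exp_smul]
    refine integral_congr_ae (ae_of_all _ fun v => ?_)
    simp only [hG, smul_eq_mul, hc]
    congr 2
    push_cast
    ring
  have h2 : ∫ v, G v = ∫ v in (-1)..1, G v := by
    refine (intervalIntegral.integral_eq_integral_of_support_subset fun v hv => ?_).symm
    have hv' : |v| < 1 := by
      by_contra! h
      exact hv (by simp [hG, triangle_eq_zero h])
    exact ⟨(abs_lt.1 hv').1, (abs_lt.1 hv').2.le⟩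
  have hexp : ∀ v : ℝ, HasDerivAt (fun v : ℝ => Complex.exp (c * v)) (Complex.exp (c * v) * c) v := by
    intro v
    have h := ((hasDerivAt_id v).ofReal_comp.const_mul c).cexp
    simpa using h
  have h3 : ∫ v in (-1)..0, G v = (1 / c - 1 / c ^ 2) + Complex.exp (-c) / c ^ 2 := by
    have hd : ∀ v ∈ Set.uIcc (-1 : ℝ) 0, HasDerivAt
        (fun v : ℝ => ((1 + v : ℂ) / c - 1 / c ^ 2) * Complex.exp (c * v)) (G v) v := by
      intro v hv
      rw [Set.uIcc_of_le (by norm_num)] at hv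
      have ht : triangle v = 1 + v := by
        rw [triangle, abs_of_nonpos hv.2, max_eq_left (by linarith [hv.1])]
        push_cast
        ring
      have hl : HasDerivAt (fun v : ℝ => ((1 + v : ℂ) / c - 1 / c ^ 2)) (1 / c) v := by
        have := (((hasDerivAt_id v).ofReal_comp.const_add (1 : ℂ)).div_const c).sub_const (1 / c ^ 2)
        simpa using this
      refine (hl.mul (hexp v)).congr_deriv ?_
      simp only [hG, ht]
      field_simp
      ring
    rw [intervalIntegral.integral_eq_sub_of_hasDerivAt hd (hGc.intervalIntegrable _ _)]
    simp
    ring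
  have h4 : ∫ v in (0)..1, G v = Complex.exp c / c ^ 2 - (1 / c + 1 / c ^ 2) := by
    have hd : ∀ v ∈ Set.uIcc (0 : ℝ) 1, HasDerivAt
        (fun v : ℝ => ((1 - v : ℂ) / c + 1 / c ^ 2) * Complex.exp (c * v)) (G v) v := by
      intro v hv
      rw [Set.uIcc_of_le (by norm_num)] at hv
      have ht : triangle v = 1 - v := by
        rw [triangle, abs_of_nonneg hv.1, max_eq_left (by linarith [hv.2])]
        push_cast
        ring
      have hl : HasDerivAt (fun v : ℝ => ((1 - v : ℂ) / c + 1 / c ^ 2)) (-1 / c) v := by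
        have := (((hasDerivAt_id v).ofReal_comp.const_sub (1 : ℂ)).div_const c).add_const (1 / c ^ 2)
        simpa using this
      refine (hl.mul (hexp v)).congr_deriv ?_
      simp only [hG, ht]
      field_simp
      ring
    rw [intervalIntegral.integral_eq_sub_of_hasDerivAt hd (hGc.intervalIntegrable _ _)]
    simp
    ring
  have h5 : Complex.exp (-c) + Complex.exp c = 2 * Complex.cos (2 * Real.pi * w) := by
    rw [Complex.two_cos, hc, neg_mul, neg_neg]
  have h6 : c ^ 2 = -(4 * (Real.pi * w) ^ 2) := by
    rw [hc, mul_pow, Complex.I_sq]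
    ring
  rw [h1, h2, ← intervalIntegral.integral_add_adjacent_intervals (hGc.intervalIntegrable _ 0)
    (hGc.intervalIntegrable _ _), h3, h4]
  have h7 : 1 / c - 1 / c ^ 2 + Complex.exp (-c) / c ^ 2 +
      (Complex.exp c / c ^ 2 - (1 / c + 1 / c ^ 2)) =
      (Complex.exp (-c) + Complex.exp c - 2) / c ^ 2 := by ring
  rw [h7, h5, h6]
  push_cast
  field_simp
  ring

lemma exists_fourier_triangle_eq (w : ℝ) : ∃ r : ℝ, 0 ≤ r ∧ 𝓕 triangle w = r := by
  by_cases hw : w = 0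
  · refine ⟨∫ t : ℝ, max (1 - |t|) 0, integral_nonneg fun t => le_max_right _ _, ?_⟩
    rw [← integral_complex_ofReal, hw, Real.fourier_real_eq_integral_exp_smul]
    simp [triangle]
  · refine ⟨_, ?_, fourier_triangle hw⟩
    have := Real.cos_le_one (2 * Real.pi * w)
    exact div_nonneg (by linarith) (by positivity)

lemma continuous_fourier_triangle : Continuous (𝓕 triangle) :=
  VectorFourier.fourierIntegral_continuous Real.continuous_fourierChar continuous_inner
    integrable_triangle

lemma integrable_fourier_triangle : Integrable (𝓕 triangle) := by
  set K := ∫ t, ‖triangle t‖ with hK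
  refine (integrable_inv_one_add_sq.const_mul (K + 1)).mono'
    continuous_fourier_triangle.aestronglyMeasurable (ae_of_all _ fun w => ?_)
  rw [← div_eq_mul_inv, le_div_iff₀ (by positivity), mul_add, mul_one]
  have h1 : ‖𝓕 triangle w‖ ≤ K := VectorFourier.norm_fourierIntegral_le_integral_norm _ _ _ _ _
  have h2 : ‖𝓕 triangle w‖ * w ^ 2 ≤ 1 := by
    by_cases hw : w = 0
    · simp [hw]
    · have h3 := Real.neg_one_le_cos (2 * Real.pi * w)
      have h4 := Real.cos_le_one (2 * Real.pi * w)
      have h5 := Real.pi_gt_three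
      rw [fourier_triangle hw, Complex.norm_real, Real.norm_of_nonneg
        (div_nonneg (by linarith) (by positivity)), mul_pow, div_mul_eq_mul_div,
        div_le_iff₀ (by positivity)]
      nlinarith [sq_nonneg w, mul_nonneg (sq_nonneg w) (by nlinarith : 0 ≤ Real.pi ^ 2 - 1)]
  linarith

lemma isProbabilityMeasure_of_fourierTransform_zero {μ : Measure ℝ} [IsFiniteMeasure μ]
    (h : fourierTransform μ 0 = 1) : IsProbabilityMeasure μ := by
  rw [fourierTransform_zero] at h
  have h1 : μ.real Set.univ = 1 := by exact_mod_cast h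
  exact ⟨by rw [← ofReal_measureReal, h1, ENNReal.ofReal_one]⟩

/-- A probability measure on `ℝ` whose Fourier transform is supported in `[-1, 1]`. -/
theorem exists_measure_fourierTransform_support :
    ∃ μ : Measure ℝ, IsProbabilityMeasure μ ∧ ∀ ξ, 1 ≤ |ξ| → fourierTransform μ ξ = 0 := by
  choose h hh0 hh using exists_fourier_triangle_eq
  have hcont : Continuous h := by
    have : h = fun w => (𝓕 triangle w).re := by
      ext w
      rw [hh, Complex.ofReal_re]
    rw [this]
    exact Complex.continuous_re.comp continuous_fourier_triangle
  have hint : Integrable h := by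
    have := integrable_fourier_triangle.re
    refine this.congr (ae_of_all _ fun w => ?_)
    change (𝓕 triangle w).re = h w
    rw [hh, Complex.ofReal_re]
  set μ := (volume : Measure ℝ).withDensity fun x => ENNReal.ofReal (h x) with hμ
  have hfin : IsFiniteMeasure μ := isFiniteMeasure_withDensity_ofReal hint.2
  -- Fourier inversion; the value 1 at the origin also makes the total mass 1.
  have hft : ∀ ξ, fourierTransform μ ξ = triangle (-ξ) := by
    intro ξ
    rw [fourierTransform_eq_integral_wave, hμ, integral_withDensity_eq_integral_toReal_smul
      (by fun_prop) (ae_of_all _ fun x => by simp),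
      ← continuous_triangle.fourierInv_fourier_eq integrable_triangle integrable_fourier_triangle,
      Real.fourierInv_eq_fourier_neg, neg_neg, Real.fourier_real_eq_integral_exp_smul]
    refine integral_congr_ae (ae_of_all _ fun x => ?_)
    simp only [hh]
    rw [ENNReal.toReal_ofReal (hh0 x), Complex.real_smul, wave, smul_eq_mul, mul_comm]
    congr 3
    push_cast
    ring
  refine ⟨μ, ?_, fun ξ hξ => ?_⟩
  · apply isProbabilityMeasure_of_fourierTransform_zero
    rw [hft]
    simp [triangle]
  · rw [hft, triangle_eq_zero (by rwa [abs_neg])]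

/-! ### Products of Fejér averages -/

lemma fejerMeasure_apply_le {μ : Measure ℝ} [IsProbabilityMeasure μ] {P : Finset ℕ} {L : ℕ}
    {A : Set ℝ} (hA : MeasurableSet A) {c : ℝ} (h : ∀ x ∈ A, fejerAverage P L x ≤ c) :
    fejerMeasure μ P L A ≤ ENNReal.ofReal c := by
  rw [fejerMeasure, withDensity_apply _ hA]
  calc ∫⁻ x in A, ENNReal.ofReal (fejerAverage P L x) ∂μ
      ≤ ∫⁻ _ in A, ENNReal.ofReal c ∂μ :=
        setLIntegral_mono measurable_const fun x hx => ENNReal.ofReal_le_ofReal (h x hx)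
    _ = ENNReal.ofReal c * μ A := by rw [setLIntegral_const]
    _ ≤ ENNReal.ofReal c * 1 := by gcongr; exact prob_le_one
    _ = _ := mul_one _

/-- The measure whose density with respect to `μ` is the product over `i ∈ S` of the Fejér averages
with parameters `P i` and `L i`. -/
noncomputable def fejerProduct (μ : Measure ℝ) (P : ℕ → Finset ℕ) (L : ℕ → ℕ) (S : Finset ℕ) :
    Measure ℝ :=
  μ.withDensity (∏ i ∈ S, fun x => ENNReal.ofReal (fejerAverage (P i) (L i) x))

section

variable (μ : Measure ℝ) (P : ℕ → Finset ℕ) (L : ℕ → ℕ)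

lemma fejerProduct_empty : fejerProduct μ P L ∅ = μ := by
  simp [fejerProduct]

lemma fejerProduct_insert {S : Finset ℕ} {a : ℕ} (ha : a ∉ S) :
    fejerProduct μ P L (insert a S) = fejerMeasure (fejerProduct μ P L S) (P a) (L a) := by
  have h : ∀ i, Measurable fun x => ENNReal.ofReal (fejerAverage (P i) (L i) x) := fun i => by
    fun_prop
  rw [fejerProduct, Finset.prod_insert ha, mul_comm,
    withDensity_mul _ (Finset.prod_induction _ _ (fun _ _ => Measurable.mul) measurable_one fun i _ => h i) (h a)]
  rfl

variable {μ P L} {D : ℕ → ℕ}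

/-- Arbitrary finite `S` are allowed because the concentration argument omits one factor from the
middle. Adjoining a new largest index `a` keeps the mass and enlarges the support radius from `D a`
to at most `D (a + 1)`. -/
lemma fejerProduct_spec [IsProbabilityMeasure μ] (hL : ∀ n, 0 < L n) (hP : ∀ n, (P n).Nonempty)
    (hPD : ∀ n, ∀ q ∈ P n, 2 * D n ≤ q) (hD : ∀ n, D n + L n * ∑ q ∈ P n, q ≤ D (n + 1))
    (hμ : ∀ ξ : ℝ, D 0 ≤ |ξ| → fourierTransform μ ξ = 0) (S : Finset ℕ) :
    IsProbabilityMeasure (fejerProduct μ P L S) ∧ ∀ n, (∀ i ∈ S, i < n) →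
      ∀ ξ : ℝ, D n ≤ |ξ| → fourierTransform (fejerProduct μ P L S) ξ = 0 := by
  have hmono : Monotone D := monotone_nat_of_le_succ fun n => le_trans (Nat.le_add_right _ _) (hD n)
  induction S using Finset.induction_on_max with
  | empty =>
    rw [fejerProduct_empty]
    refine ⟨inferInstance, fun n _ ξ hξ => hμ ξ (le_trans ?_ hξ)⟩
    exact_mod_cast hmono (Nat.zero_le n)
  | insert a S ha ih =>
    obtain ⟨hprob, hsupp⟩ := ih
    rw [fejerProduct_insert _ _ _ fun h => (ha a h).false]
    have hPD' : ∀ q ∈ P a, (2 * D a : ℝ) ≤ q := fun q hq => by exact_mod_cast hPD a q hq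
    refine ⟨isProbabilityMeasure_of_fourierTransform_zero ?_, fun n hn ξ hξ => ?_⟩
    · rw [fourierTransform_fejerMeasure_eq (hP a) (hL a) (hsupp a ha) hPD' (by simp),
        fourierTransform_zero, probReal_univ, Complex.ofReal_one]
    · refine fourierTransform_fejerMeasure_eq_zero (hsupp a ha) (le_trans ?_ hξ)
      have h1 : ((D a + L a * ∑ q ∈ P a, q : ℕ) : ℝ) ≤ D n :=
        Nat.cast_le.2 ((hD a).trans (hmono (hn a (Finset.mem_insert_self _ _))))
      push_cast at h1
      exact h1

end

/-! ### The weak limit and the measure on the Liouville numbers -/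

/-- A sequence of probability measures whose Fourier transforms are eventually constant at every
point has a weak limit along an ultrafilter. -/
lemma exists_tendsto_hyperfilter (m : ℕ → ProbabilityMeasure ℝ) (D : ℕ → ℕ)
    (hDn : ∀ n, n + 1 ≤ D n)
    (hconst : ∀ n (ξ : ℝ), |ξ| ≤ D n →
      fourierTransform (m (n + 1) : Measure ℝ) ξ = fourierTransform (m n : Measure ℝ) ξ) :
    ∃ μ : ProbabilityMeasure ℝ, Tendsto m (hyperfilter ℕ) (nhds μ) ∧
      ∀ ξ, ∃ n, fourierTransform (μ : Measure ℝ) ξ = fourierTransform (m n : Measure ℝ) ξ := by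
  have hstable : ∀ (n k : ℕ) (ξ : ℝ), n ≤ k → |ξ| ≤ n + 1 →
      fourierTransform (m k : Measure ℝ) ξ = fourierTransform (m n : Measure ℝ) ξ := by
    intro n k ξ hnk hξ
    induction k, hnk using Nat.le_induction with
    | base => rfl
    | succ k hk ih =>
      rw [hconst k ξ, ih]
      have h1 : (k + 1 : ℝ) ≤ D k := by exact_mod_cast hDn k
      have h2 : (n : ℝ) ≤ k := by exact_mod_cast hk
      linarith
  have hpi := Real.pi_pos
  set N : ℝ → ℕ := fun t => ⌊|t / (2 * Real.pi)|⌋₊ with hN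
  have hNle : ∀ t, |-(t / (2 * Real.pi))| ≤ N t + 1 := fun t => by
    rw [abs_neg]
    exact (Nat.lt_floor_add_one _).le
  set φ : ℝ → ℂ := fun t => charFun (m (N t) : Measure ℝ) t with hφ
  have hlim : ∀ t, Tendsto (fun n => charFun (m n : Measure ℝ) t) atTop (nhds (φ t)) := by
    intro t
    refine tendsto_const_nhds.congr' ?_
    filter_upwards [eventually_ge_atTop (N t)] with n hn
    simp only [hφ]
    rw [charFun_eq_fourierTransform, charFun_eq_fourierTransform, hstable _ _ _ hn (hNle t)]
  -- Near 0 the index `N t` is 0, so `φ` is there a genuine characteristic function; continuity at 0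
  -- yields tightness.
  have hcont : ContinuousAt φ 0 := by
    have h0 : φ =ᶠ[nhds 0] charFun (m 0 : Measure ℝ) := by
      filter_upwards [Metric.ball_mem_nhds (0 : ℝ) one_pos] with t ht
      rw [mem_ball_zero_iff, Real.norm_eq_abs] at ht
      have : N t = 0 := by
        rw [hN, Nat.floor_eq_zero, abs_div, abs_of_pos (by positivity : 0 < 2 * Real.pi),
          div_lt_one (by positivity)]
        linarith [Real.pi_gt_three]
      simp only [hφ, this]
    have hc : Continuous (charFun (m 0 : Measure ℝ)) := by fun_prop
    exact hc.continuousAt.congr h0.symm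
  have htight : IsTightMeasureSet (Set.range fun n => (m n : Measure ℝ)) :=
    isTightMeasureSet_of_tendsto_charFun hcont hlim
  have hcompact : IsCompact (closure (Set.range m)) := by
    refine isCompact_closure_of_isTightMeasureSet (htight.subset ?_)
    rintro _ ⟨_, ⟨n, rfl⟩, rfl⟩
    exact ⟨n, rfl⟩
  obtain ⟨μ, -, hμ⟩ := hcompact.ultrafilter_le_nhds ((hyperfilter ℕ).map m)
    (le_principal_iff.2 (Filter.mem_map.2 (Filter.univ_mem' fun n =>
      subset_closure ⟨n, rfl⟩)))
  have hμ' : Tendsto m (hyperfilter ℕ) (nhds μ) := hμ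
  refine ⟨μ, hμ', fun ξ => ?_⟩
  set t := -(2 * Real.pi * ξ) with ht
  have hξ : -(t / (2 * Real.pi)) = ξ := by
    rw [ht]
    field_simp
  have h1 : Tendsto (fun n => charFun (m n : Measure ℝ) t) (hyperfilter ℕ)
      (nhds (charFun (μ : Measure ℝ) t)) := by
    rw [ProbabilityMeasure.tendsto_iff_forall_integral_rclike_tendsto ℂ] at hμ'
    simp_rw [charFun_eq_integral_innerProbChar]
    exact hμ' (BoundedContinuousFunction.innerProbChar t)
  have h2 := tendsto_nhds_unique h1 ((hlim t).mono_left Nat.hyperfilter_le_atTop)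
  refine ⟨N t, ?_⟩
  simp only [hφ] at h2
  rwa [charFun_eq_fourierTransform, charFun_eq_fourierTransform, hξ] at h2

/-- For every function `F` that vanishes at infinity, but more slowly than any power, some
probability measure carried by the Liouville numbers has Fourier transform bounded by `F`. -/
theorem exists_measure_liouvilleNumbers {F : ℝ → ℝ} (hF0 : ∀ ξ, 0 ≤ F ξ)
    (hF : ∀ α : ℝ, 0 < α → ∀ᶠ ξ in atTop, ξ ^ (-α) ≤ F ξ) (hFlim : Tendsto F atTop (nhds 0)) :
    ∃ μ ∈ probabilityMeasuresOn liouvilleNumbers,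
      ∀ ξ : ℝ, 1 ≤ |ξ| → ‖fourierTransform μ ξ‖ ≤ F |ξ| := by
  obtain ⟨μ₀, hμ₀, hsupp₀⟩ := exists_measure_fourierTransform_support
  choose P' L' δ' hP' hL' hq' hres' hconc' using exists_fejerAverage hF0 hF
  -- `D n` bounds the support of the transform before stage `n`, whose parameters depend on it.
  obtain ⟨D, hD0, hDsucc⟩ : ∃ D : ℕ → ℕ, D 0 = 1 ∧
      ∀ n, D (n + 1) = D n + L' n (D n) * ∑ q ∈ P' n (D n), q :=
    ⟨fun n => Nat.rec 1 (fun n d => d + L' n d * ∑ q ∈ P' n d, q) n, rfl, fun _ => rfl⟩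
  set P := fun n => P' n (D n) with hP
  set L := fun n => L' n (D n) with hL
  have hspec := fejerProduct_spec (μ := μ₀) (P := P) (L := L) (D := D) (fun n => hL' n _)
    (fun n => hP' n _) (fun n q hq => (hq' n _ q hq).2.1) (fun n => (hDsucc n).ge)
    (fun ξ hξ => hsupp₀ ξ (by simpa [hD0] using hξ))
  have hDn : ∀ n, n + 1 ≤ D n := by
    intro n
    induction n with
    | zero => rw [hD0]
    | succ n ih =>
      have h1 : 0 < L n * ∑ q ∈ P n, q := Nat.mul_pos (hL' n _)
        (Finset.sum_pos (fun q hq => (hq' n _ q hq).1.pos) (hP' n _))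
      have h2 := hDsucc n
      simp only [hP, hL] at h1
      omega
  set m : ℕ → ProbabilityMeasure ℝ :=
    fun n => ⟨fejerProduct μ₀ P L (Finset.range n), (hspec _).1⟩ with hm
  have hmsucc : ∀ n, (m (n + 1) : Measure ℝ) = fejerMeasure (m n : Measure ℝ) (P n) (L n) := by
    intro n
    simp only [hm, ProbabilityMeasure.coe_mk]
    rw [Finset.range_add_one, fejerProduct_insert _ _ _ Finset.notMem_range_self]
  have hmsupp : ∀ n (ξ : ℝ), D n ≤ |ξ| → fourierTransform (m n : Measure ℝ) ξ = 0 :=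
    fun n => (hspec (Finset.range n)).2 n fun i hi => Finset.mem_range.1 hi
  have hPD : ∀ n, ∀ q ∈ P n, (2 * D n : ℝ) ≤ q :=
    fun n q hq => by exact_mod_cast (hq' n _ q hq).2.1
  have hconst : ∀ n (ξ : ℝ), |ξ| ≤ D n →
      fourierTransform (m (n + 1) : Measure ℝ) ξ = fourierTransform (m n : Measure ℝ) ξ := by
    intro n ξ hξ
    rw [hmsucc]
    exact fourierTransform_fejerMeasure_eq (hP' n _) (hL' n _) (hmsupp n) (hPD n) hξ
  -- Up to `D n` nothing changes at stage `n`; beyond it the old transform vanishes and only the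
  -- resonant proportion remains.
  have hdecay : ∀ n (ξ : ℝ), 1 ≤ |ξ| → ‖fourierTransform (m n : Measure ℝ) ξ‖ ≤ F |ξ| := by
    intro n
    induction n with
    | zero =>
      intro ξ hξ
      rw [hmsupp 0 ξ (by simpa [hD0] using hξ), norm_zero]
      exact hF0 _
    | succ n ih =>
      intro ξ hξ
      rcases le_total |ξ| (D n) with h | h
      · rw [hconst n ξ h]
        exact ih ξ hξ
      · have h1 := norm_fourierTransform_fejerMeasure_sub_le (hP' n _) (hL' n (D n)) (hmsupp n)
          (hPD n) ξ
        rw [hmsupp n ξ h, sub_zero, probReal_univ, one_mul] at h1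
        rw [hmsucc]
        exact h1.trans (hres' n _ ξ)
  obtain ⟨μ, hμlim, hμ⟩ := exists_tendsto_hyperfilter m D hDn hconst
  have hμdecay : ∀ ξ : ℝ, 1 ≤ |ξ| → ‖fourierTransform (μ : Measure ℝ) ξ‖ ≤ F |ξ| := by
    intro ξ hξ
    obtain ⟨n, hn⟩ := hμ ξ
    rw [hn]
    exact hdecay n ξ hξ
  have hconc : ∀ n, (μ : Measure ℝ) (nearRationals (P n) (δ' n (D n)))ᶜ ≤
      ENNReal.ofReal ((1 / 2) ^ n) := by
    intro n
    have hopen := isOpen_compl_nearRationals (P n) (δ' n (D n))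
    refine (ProbabilityMeasure.le_liminf_measure_open_of_tendsto hμlim hopen).trans
      ((liminf_le_limsup).trans (limsup_le_of_le (by isBoundedDefault) ?_))
    refine Nat.hyperfilter_le_atTop ?_
    filter_upwards [eventually_gt_atTop n] with k hk
    -- Factor `n` is applied last, to a probability measure built from the other factors, so its
    -- pointwise bound controls the mass.
    have hmk : (m k : Measure ℝ) =
        fejerMeasure (fejerProduct μ₀ P L ((Finset.range k).erase n)) (P n) (L n) := by
      rw [← fejerProduct_insert _ _ _ (Finset.notMem_erase _ _),
        Finset.insert_erase (Finset.mem_range.2 hk)]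
      rfl
    rw [hmk]
    have := (hspec ((Finset.range k).erase n)).1
    exact fejerMeasure_apply_le hopen.measurableSet (hconc' n _)
  have hae1 : ∀ᵐ x ∂(μ : Measure ℝ), ∀ᶠ n in atTop, x ∈ nearRationals (P n) (δ' n (D n)) := by
    have hsum : ∑' n, (μ : Measure ℝ) (nearRationals (P n) (δ' n (D n)))ᶜ ≠ ⊤ :=
      ne_top_of_le_ne_top (summable_geometric_two.tsum_ofReal_ne_top) (ENNReal.tsum_le_tsum hconc)
    filter_upwards [ae_eventually_notMem hsum] with x hx
    exact hx.mono fun n hn => not_not.1 hn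
  have hae2 : ∀ᵐ x ∂(μ : Measure ℝ), x ∉ Set.range ((↑) : ℚ → ℝ) := by
    refine measure_eq_zero_iff_ae_notMem.1 (measure_range_ratCast_eq_zero _ ?_)
    rw [← Metric.cobounded_eq_cocompact]
    refine squeeze_zero_norm' ?_ (hFlim.comp tendsto_norm_cobounded_atTop)
    filter_upwards [tendsto_norm_cobounded_atTop.eventually_ge_atTop 1] with ξ hξ
    exact hμdecay ξ hξ
  refine ⟨μ, ⟨inferInstance, ?_⟩, hμdecay⟩
  change ∀ᵐ x ∂(μ : Measure ℝ), x ∈ liouvilleNumbers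
  filter_upwards [hae1, hae2] with x hx1 hx2
  intro n
  obtain ⟨k, ⟨q, hq, a, ha⟩, hk⟩ := (hx1.and (eventually_ge_atTop n)).exists
  obtain ⟨hqp, -, hδ⟩ := hq' k _ q hq
  have hq1 : (1 : ℝ) < q := by exact_mod_cast hqp.one_lt
  refine ⟨a, q, by exact_mod_cast hqp.one_lt, fun h => hx2 ⟨a / q, by rw [h]; push_cast; rfl⟩, ?_⟩
  push_cast
  have h1 : |x - a / q| * q = |x * q - a| := by
    rw [← Nat.abs_cast q, ← abs_mul, Nat.abs_cast]
    congr 1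
    field_simp
  have h2 : |x - a / q| < 1 / (q : ℝ) ^ k := by
    have h3 : |x - a / q| * q < q * (1 / (q : ℝ) ^ k) := by
      rw [h1]
      exact ha.trans_lt hδ
    nlinarith
  refine h2.trans_le ?_
  gcongr
  exact hq1.le

/-! ### Equivalence of the growth conditions -/

lemma map_exp_toNNReal_atTop : map (fun γ : ℝ => (Real.exp γ).toNNReal) atTop = atTop := by
  have h : (fun γ : ℝ => (Real.exp γ).toNNReal) = Real.toNNReal ∘ Real.exp := rfl
  rw [h, ← map_map, Real.map_exp_atTop, Real.map_toNNReal_atTop]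

lemma phi_div_eq_tau (f : ℝ≥0 → ℝ≥0) (γ : ℝ) :
    phi f γ / γ = tau f (Real.exp γ).toNNReal := by
  rw [tau, phi, Real.coe_toNNReal _ (Real.exp_pos γ).le, Real.log_exp]

lemma limsup_phi_eq (f : ℝ≥0 → ℝ≥0) :
    limsup (fun γ : ℝ => ((phi f γ / γ : ℝ) : EReal)) atTop =
      limsup (fun ξ : ℝ≥0 => (tau f ξ : EReal)) atTop := by
  simp_rw [phi_div_eq_tau]
  conv_rhs => rw [← map_exp_toNNReal_atTop]
  rfl

lemma liminf_phi_eq (f : ℝ≥0 → ℝ≥0) :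
    liminf (fun γ : ℝ => ((phi f γ / γ : ℝ) : EReal)) atTop =
      liminf (fun ξ : ℝ≥0 => (tau f ξ : EReal)) atTop := by
  simp_rw [phi_div_eq_tau]
  conv_rhs => rw [← map_exp_toNNReal_atTop]
  rfl

lemma limsup_coe_ereal_le_zero {ι : Type*} {l : Filter ι} {u : ι → ℝ}
    (h : ∀ ε : ℝ, 0 < ε → ∀ᶠ i in l, u i ≤ ε) : limsup (fun i => (u i : EReal)) l ≤ 0 := by
  refine EReal.le_of_forall_lt_iff_le.1 fun ε hε => limsup_le_of_le (by isBoundedDefault) ?_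
  filter_upwards [h ε (by exact_mod_cast hε)] with i hi
  exact_mod_cast hi

lemma zero_le_limsup_coe_ereal {ι : Type*} {l : Filter ι} [l.NeBot] {u : ι → ℝ}
    (h : ∀ ε : ℝ, 0 < ε → ∀ᶠ i in l, -ε ≤ u i) : 0 ≤ limsup (fun i => (u i : EReal)) l := by
  refine le_trans ?_ liminf_le_limsup
  refine EReal.ge_of_forall_gt_iff_ge.1 fun ε hε => le_liminf_of_le (by isBoundedDefault) ?_
  filter_upwards [h (-ε) (by have : ε < 0 := by exact_mod_cast hε
                             linarith)] with i hi
  rw [neg_neg] at hi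
  exact_mod_cast hi

lemma zero_lt_liminf_coe_ereal_iff {ι : Type*} {l : Filter ι} {u : ι → ℝ} :
    0 < liminf (fun i => (u i : EReal)) l ↔ ∃ c : ℝ, 0 < c ∧ ∀ᶠ i in l, c ≤ u i := by
  constructor
  · intro h
    obtain ⟨c, hc0, hc⟩ := EReal.lt_iff_exists_real_btwn.1 h
    refine ⟨c, by exact_mod_cast hc0, ?_⟩
    filter_upwards [eventually_lt_of_lt_liminf hc] with i hi
    exact_mod_cast hi.le
  · rintro ⟨c, hc0, hc⟩
    refine lt_of_lt_of_le (b := (c : EReal)) (by exact_mod_cast hc0)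
      (le_liminf_of_le (by isBoundedDefault) ?_)
    filter_upwards [hc] with i hi
    exact_mod_cast hi

lemma eventually_one_lt_nnreal : ∀ᶠ ξ : ℝ≥0 in atTop, (1 : ℝ) < ξ := by
  filter_upwards [eventually_gt_atTop 1] with ξ hξ
  exact_mod_cast hξ

lemma eventually_rpow_neg_le {α ε : ℝ} (hα : 0 < α) (hε : 0 < ε) :
    ∀ᶠ ξ : ℝ≥0 in atTop, (ξ : ℝ) ^ (-α) ≤ ε :=
  ((tendsto_rpow_neg_atTop hα).comp (NNReal.tendsto_coe_atTop.2 tendsto_id)).eventually_le_const hε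

section

variable {f : ℝ≥0 → ℝ≥0}

lemma tau_le_iff (hpos : ∀ ξ, 0 < f ξ) {ξ : ℝ≥0} (hξ : (1 : ℝ) < ξ) (α : ℝ) :
    tau f ξ ≤ α ↔ (ξ : ℝ) ^ (-α) ≤ f ξ := by
  have h0 : (0 : ℝ) < ξ := by linarith
  have hf : (0 : ℝ) < f ξ := by exact_mod_cast hpos ξ
  rw [tau, div_le_iff₀ (Real.log_pos hξ), ← Real.log_le_log_iff (by positivity) hf,
    Real.log_rpow h0]
  constructor <;> intro h <;> linarith

lemma le_tau_iff (hpos : ∀ ξ, 0 < f ξ) {ξ : ℝ≥0} (hξ : (1 : ℝ) < ξ) (α : ℝ) :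
    α ≤ tau f ξ ↔ (f ξ : ℝ) ≤ (ξ : ℝ) ^ (-α) := by
  have h0 : (0 : ℝ) < ξ := by linarith
  have hf : (0 : ℝ) < f ξ := by exact_mod_cast hpos ξ
  rw [tau, le_div_iff₀ (Real.log_pos hξ), ← Real.log_le_log_iff hf (by positivity),
    Real.log_rpow h0]
  constructor <;> intro h <;> linarith

/-- The power bounds only give `limsup ≤ 0`; boundedness of `f` supplies the reverse inequality. -/
lemma limsup_tau_eq_zero_iff (hpos : ∀ ξ, 0 < f ξ) (hbdd : BddAbove (Set.range f)) :
    limsup (fun ξ : ℝ≥0 => (tau f ξ : EReal)) atTop = 0 ↔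
      ∀ α : ℝ, 0 < α → ∀ᶠ ξ : ℝ≥0 in atTop, (ξ : ℝ) ^ (-α) ≤ f ξ := by
  constructor
  · intro h α hα
    have h1 : limsup (fun ξ : ℝ≥0 => (tau f ξ : EReal)) atTop < (α : EReal) := by
      rw [h]
      exact_mod_cast hα
    filter_upwards [eventually_lt_of_limsup_lt h1, eventually_one_lt_nnreal] with ξ hξ hξ1
    exact (tau_le_iff hpos hξ1 α).1 (by exact_mod_cast hξ.le)
  · intro h
    refine le_antisymm (limsup_coe_ereal_le_zero fun ε hε => ?_)
      (zero_le_limsup_coe_ereal fun ε hε => ?_)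
    · filter_upwards [h ε hε, eventually_one_lt_nnreal] with ξ hξ hξ1
      exact (tau_le_iff hpos hξ1 ε).2 hξ
    · obtain ⟨C, hC⟩ := hbdd
      have hC0 : 0 < C := (hpos 0).trans_le (hC ⟨0, rfl⟩)
      filter_upwards [eventually_rpow_neg_le hε (by positivity : (0 : ℝ) < 1 / C),
        eventually_one_lt_nnreal] with ξ hξ hξ1
      have h0 : (0 : ℝ) < ξ := by linarith
      have hC0' : (0 : ℝ) < C := by exact_mod_cast hC0
      rw [le_tau_iff hpos hξ1, neg_neg]
      have h1 : (f ξ : ℝ) ≤ C := by exact_mod_cast hC ⟨ξ, rfl⟩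
      refine h1.trans ?_
      rw [Real.rpow_neg h0.le, one_div] at hξ
      exact (inv_le_inv₀ (by positivity) hC0').1 hξ

/-- The bound for `α / 2` leaves a spare factor `ξ^(-α/2)`, which tends to 0. -/
lemma slowDecay_iff (hpos : ∀ ξ, 0 < f ξ) :
    SlowDecay f ↔ ∀ α : ℝ, 0 < α → ∀ᶠ ξ : ℝ≥0 in atTop, (ξ : ℝ) ^ (-α) ≤ f ξ := by
  have hf : ∀ ξ, (0 : ℝ) < f ξ := fun ξ => by exact_mod_cast hpos ξ
  constructor
  · intro h α hα
    have h1 := h α hα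
    have h2 : limsup (fun ξ : ℝ≥0 => (((ξ : ℝ) ^ (-α) / (f ξ : ℝ) : ℝ) : EReal)) atTop <
        ((1 : ℝ) : EReal) := by
      rw [h1]
      exact_mod_cast one_pos
    filter_upwards [eventually_lt_of_limsup_lt h2] with ξ hξ
    have h3 : (ξ : ℝ) ^ (-α) / (f ξ : ℝ) ≤ 1 := by exact_mod_cast hξ.le
    rwa [div_le_one (hf ξ)] at h3
  · intro h α hα
    refine le_antisymm (limsup_coe_ereal_le_zero fun ε hε => ?_)
      (zero_le_limsup_coe_ereal fun ε hε => ?_)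
    · filter_upwards [h (α / 2) (by positivity), eventually_rpow_neg_le (half_pos hα) hε,
        eventually_one_lt_nnreal] with ξ h1 h2 h3
      have h0 : (0 : ℝ) < ξ := by linarith
      rw [div_le_iff₀ (hf ξ), show -α = -(α / 2) + -(α / 2) by ring, Real.rpow_add h0]
      gcongr
    · refine Eventually.of_forall fun ξ => ?_
      have : 0 ≤ (ξ : ℝ) ^ (-α) / (f ξ : ℝ) := by positivity
      linarith

lemma zero_lt_liminf_tau_iff (hpos : ∀ ξ, 0 < f ξ) :
    0 < liminf (fun ξ : ℝ≥0 => (tau f ξ : EReal)) atTop ↔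
      ∃ α : ℝ, 0 < α ∧ ∀ᶠ ξ : ℝ≥0 in atTop, (f ξ : ℝ) ≤ (ξ : ℝ) ^ (-α) := by
  rw [zero_lt_liminf_coe_ereal_iff]
  refine exists_congr fun α => and_congr_right fun _ => ?_
  refine eventually_congr ?_
  filter_upwards [eventually_one_lt_nnreal] with ξ hξ
  exact le_tau_iff hpos hξ α

/-- Halving the exponent absorbs the constant in the lower limit. -/
lemma powerDecay_iff (hpos : ∀ ξ, 0 < f ξ) :
    PowerDecay f ↔
      ∃ α : ℝ, 0 < α ∧ ∀ᶠ ξ : ℝ≥0 in atTop, (f ξ : ℝ) ≤ (ξ : ℝ) ^ (-α) := by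
  have hf : ∀ ξ, (0 : ℝ) < f ξ := fun ξ => by exact_mod_cast hpos ξ
  constructor
  · rintro ⟨α, hα, h⟩
    obtain ⟨c, hc, h1⟩ := zero_lt_liminf_coe_ereal_iff.1 h
    refine ⟨α / 2, by positivity, ?_⟩
    filter_upwards [h1, eventually_rpow_neg_le (half_pos hα) hc, eventually_one_lt_nnreal]
      with ξ h2 h3 h4
    have h0 : (0 : ℝ) < ξ := by linarith
    have h5 : 0 < (ξ : ℝ) ^ (-(α / 2)) := by positivity
    rw [le_div_iff₀ (hf ξ), show -α = -(α / 2) + -(α / 2) by ring, Real.rpow_add h0] at h2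
    have h6 : (ξ : ℝ) ^ (-(α / 2)) * f ξ ≤ (ξ : ℝ) ^ (-(α / 2)) * (ξ : ℝ) ^ (-(α / 2)) :=
      (mul_le_mul_of_nonneg_right h3 (hf ξ).le).trans h2
    exact le_of_mul_le_mul_left h6 h5
  · rintro ⟨α, hα, h⟩
    refine ⟨α, hα, zero_lt_liminf_coe_ereal_iff.2 ⟨1, one_pos, ?_⟩⟩
    filter_upwards [h] with ξ hξ
    rwa [one_le_div (hf ξ)]

/-! ### Membership in the Fourier set -/

lemma tendsto_nnnorm_cocompact_real : Tendsto (fun ξ : ℝ => ‖ξ‖₊) (cocompact ℝ) atTop := by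
  rw [← NNReal.tendsto_coe_atTop]
  exact tendsto_norm_cocompact_atTop

theorem decayClass_mem_fourierSet_liouvilleNumbers
    (h : ∀ α : ℝ, 0 < α → ∀ᶠ ξ : ℝ≥0 in atTop, (ξ : ℝ) ^ (-α) ≤ f ξ) :
    decayClass f ∈ fourierSet liouvilleNumbers := by
  -- Since `f` need not tend to 0, it is capped by a function that does, more slowly than any power;
  -- the shift by 2 keeps the logarithm positive.
  set F : ℝ → ℝ := fun ξ => min (f ξ.toNNReal : ℝ) (1 / Real.log (|ξ| + 2)) with hF
  have hlog : ∀ ξ : ℝ, 0 < Real.log (|ξ| + 2) := fun ξ =>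
    Real.log_pos (by linarith [abs_nonneg ξ])
  have hF0 : ∀ ξ, 0 ≤ F ξ := fun ξ => le_min (by positivity) (one_div_nonneg.2 (hlog ξ).le)
  have hFlim : Tendsto F atTop (nhds 0) := by
    refine squeeze_zero hF0 (fun ξ => min_le_right _ _) ?_
    simp_rw [one_div]
    exact tendsto_inv_atTop_zero.comp (Real.tendsto_log_atTop.comp
      (tendsto_atTop_add_const_right _ _ tendsto_abs_atTop_atTop))
  have hFslow : ∀ α : ℝ, 0 < α → ∀ᶠ ξ in atTop, ξ ^ (-α) ≤ F ξ := by
    intro α hα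
    have h1 := (isLittleO_log_rpow_atTop hα).bound (show (0 : ℝ) < 1 / 2 by norm_num)
    filter_upwards [tendsto_real_toNNReal_atTop.eventually (h α hα), h1, eventually_ge_atTop 2]
      with ξ h2 h3 h4
    have h0 : 0 < ξ := by linarith
    rw [Real.coe_toNNReal _ h0.le] at h2
    refine le_min h2 ?_
    rw [Real.rpow_neg h0.le, ← one_div]
    apply one_div_le_one_div_of_le (hlog ξ)
    rw [abs_of_pos h0]
    rw [Real.norm_of_nonneg (Real.log_nonneg (by linarith)),
      Real.norm_of_nonneg (by positivity)] at h3
    calc Real.log (ξ + 2) ≤ Real.log (ξ ^ 2) := Real.log_le_log (by linarith) (by nlinarith)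
      _ = 2 * Real.log ξ := by rw [Real.log_pow]; norm_num
      _ ≤ ξ ^ α := by linarith
  obtain ⟨μ, hμ, hdecay⟩ := exists_measure_liouvilleNumbers hF0 hFslow hFlim
  refine ⟨f, ⟨μ, hμ, IsBigO.of_bound 1 ?_⟩, rfl⟩
  filter_upwards [(tendsto_norm_cocompact_atTop (E := ℝ)).eventually_ge_atTop 1] with ξ hξ
  refine (hdecay ξ hξ).trans ((min_le_left _ _).trans ?_)
  rw [one_mul, Real.norm_of_nonneg (NNReal.coe_nonneg _), ← Real.norm_eq_abs, norm_toNNReal]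

theorem decayClass_notMem_fourierSet_liouvilleNumbers
    (h : ∃ α : ℝ, 0 < α ∧ ∀ᶠ ξ : ℝ≥0 in atTop, (f ξ : ℝ) ≤ (ξ : ℝ) ^ (-α)) :
    decayClass f ∉ fourierSet liouvilleNumbers := by
  rintro ⟨g, ⟨μ, ⟨hμ, hcarried⟩, hg⟩, hgf⟩
  obtain ⟨α, hα, hf⟩ := h
  have hgf' : (fun ξ : ℝ≥0 => (g ξ : ℝ)) =O[atTop] fun ξ => (f ξ : ℝ) := (Quotient.exact hgf).1
  have hfα : (fun ξ : ℝ≥0 => (f ξ : ℝ)) =O[atTop] fun ξ => (ξ : ℝ) ^ (-α) := by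
    refine IsBigO.of_bound 1 ?_
    filter_upwards [hf] with ξ hξ
    rwa [one_mul, Real.norm_of_nonneg (NNReal.coe_nonneg _), Real.norm_of_nonneg (by positivity)]
  have hμα := hg.trans ((hgf'.trans hfα).comp_tendsto tendsto_nnnorm_cocompact_real)
  obtain ⟨C, hC⟩ := hμα.bound
  rw [← Metric.cobounded_eq_cocompact, ← comap_norm_atTop, eventually_comap] at hC
  obtain ⟨R, hR⟩ := eventually_atTop.1 hC
  have hnull : μ liouvilleNumbers = 0 := by
    refine measure_liouvilleNumbers_eq_zero μ (C := C) (R := R) hα fun ξ hξ => ?_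
    have h1 := hR |ξ| hξ ξ rfl
    simp only [Function.comp_apply, coe_nnnorm, Real.norm_eq_abs] at h1
    rwa [abs_of_nonneg (by positivity)] at h1
  have hone : μ Set.univ = 1 := hμ.measure_univ
  have hle := measure_union_le (μ := μ) liouvilleNumbers liouvilleNumbersᶜ
  rw [Set.union_compl_self, hone, hnull, hcarried, add_zero] at hle
  simp at hle

end

end LiouvilleFourier

theorem mainTheorem3 (f : ℝ≥0 → ℝ≥0) (hpos : ∀ ξ, 0 < f ξ)
    (hbdd : BddAbove (Set.range f)) (hreg : Antitone f ∨ Continuous f) :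
    ((limsup (fun ξ : ℝ≥0 => (LiouvilleFourier.tau f ξ : EReal)) atTop = 0 ↔
          LiouvilleFourier.SlowDecay f) ∧
      (limsup (fun γ : ℝ => ((LiouvilleFourier.phi f γ / γ : ℝ) : EReal)) atTop = 0 ↔
          LiouvilleFourier.SlowDecay f) ∧
      (limsup (fun ξ : ℝ≥0 => (LiouvilleFourier.tau f ξ : EReal)) atTop = 0 →
          LiouvilleFourier.decayClass f ∈
            LiouvilleFourier.fourierSet LiouvilleFourier.liouvilleNumbers) ∧
      (limsup (fun γ : ℝ => ((LiouvilleFourier.phi f γ / γ : ℝ) : EReal)) atTop = 0 →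
          LiouvilleFourier.decayClass f ∈
            LiouvilleFourier.fourierSet LiouvilleFourier.liouvilleNumbers)) ∧
    ((0 < liminf (fun ξ : ℝ≥0 => (LiouvilleFourier.tau f ξ : EReal)) atTop ↔
          LiouvilleFourier.PowerDecay f) ∧
      (0 < liminf (fun γ : ℝ => ((LiouvilleFourier.phi f γ / γ : ℝ) : EReal)) atTop ↔
          LiouvilleFourier.PowerDecay f) ∧
      (0 < liminf (fun ξ : ℝ≥0 => (LiouvilleFourier.tau f ξ : EReal)) atTop →
          LiouvilleFourier.decayClass f ∉
            LiouvilleFourier.fourierSet LiouvilleFourier.liouvilleNumbers) ∧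
      (0 < liminf (fun γ : ℝ => ((LiouvilleFourier.phi f γ / γ : ℝ) : EReal)) atTop →
          LiouvilleFourier.decayClass f ∉
            LiouvilleFourier.fourierSet LiouvilleFourier.liouvilleNumbers)) := by
  open LiouvilleFourier in
  rw [limsup_phi_eq, liminf_phi_eq, limsup_tau_eq_zero_iff hpos hbdd, slowDecay_iff hpos,
    zero_lt_liminf_tau_iff hpos, powerDecay_iff hpos]
  exact ⟨⟨Iff.rfl, Iff.rfl, LiouvilleFourier.decayClass_mem_fourierSet_liouvilleNumbers,
    LiouvilleFourier.decayClass_mem_fourierSet_liouvilleNumbers⟩, Iff.rfl, Iff.rfl,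
    LiouvilleFourier.decayClass_notMem_fourierSet_liouvilleNumbers,
    LiouvilleFourier.decayClass_notMem_fourierSet_liouvilleNumbers⟩
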